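/- Let $0<\rho\le v_{\max}$. A buyer with total budget $B=\rho T$ takes part in $T$ repeated second-price auctions. In round $t$ she sees her value $v_t\in[0,v_{\max}]$, decides $x_t\in\{0,1\}$ (enter or not), and gets revenue $x_t r_t$ and pays $x_t c_t$, where $r_t=(v_t-p_t)^+$, $c_t=p_t\mathbf 1[v_t\ge p_t]$ and $p_t$ is the highest competing bid. The values $\bm v\in[0,v_{\max}]^T$ are arbitrary (adversarial), the bids $p_1,\dots,p_T$ are i.i.d. from a probability distribution $G$ on $[0,v_{\max}]$ unknown to the buyer, and $p_t$ is revealed at the end of round $t$ whatever $x_t$ is (full information feedback). The OGD-CB algorithm starts with $B_1=\rho T$, $\lambda_1=0$, $\mathcal I_1=\emptyset$ and does the following for $t=1,\dots,T$. If $t=1$, it sets $x_1=1$ and $\lambda_2=\lambda_1$. If $t\ge2$, it sets $$\epsilon_t=\sqrt{\tfrac{\ln 2+2\ln T}{2|\mathcal I_t|}},\quad \tilde r_t=\frac{1}{|\mathcal I_t|}\sum_{\tau\in\mathcal I_t}(v_t-p_\tau)^++\epsilon_tv_t,\quad \tilde c_t=\frac1{|\mathcal I_t|}\sum_{\tau\in\mathcal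 I_t}p_\tau\mathbf 1[v_t\ge p_\tau]-2\epsilon_tv_t,$$ $$x_t=\mathbf 1[\tilde r_t\ge\lambda_t\tilde c_t],\qquad \lambda_{t+1}=\Bigl(\lambda_t+\tfrac{1}{v_{\max}\sqrt t}(x_t\tilde c_t-\rho)\Bigr)^+ .$$ In either case it then observes $p_t$, sets $\mathcal I_{t+1}=\mathcal I_t\cup\{t\}$ and $B_{t+1}=B_t-x_tc_t$, and stops for good (all later decisions are $0$) if $B_{t+1}<v_{\max}$. Let $\mathrm{Rev}_T(\bm v,\bm p)=\sum_{t=1}^T x_tr_t$ be the total revenue of OGD-CB, and let $$\mathrm{OPT}^{\mathrm H}_T(\bm v,\bm p)=\max\Bigl\{\sum_{t=1}^T y_t(v_t-p_t)^+ : \bm y\in\{0,1\}^T,\ \sum_{t=1}^T y_tp_t\mathbf 1[v_t\ge p_t]\le T\rho\Bigr\}$$ be the hindsight benchmark. Then OGD-CB is asymptotically $(\rho/v_{\max})$-competitive: the random variable in the expectation below is integrable for all $T$, $\bm v$, $G$, and $$\liminf_{T\to\infty}\ \inf_{\bm v\in[0,v_{\max}]^T,\ G}\ \frac1T\,\mathbb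 E_{\bm p\sim G^T}\Bigl[\mathrm{Rev}_T(\bm v,\bm p)-\frac{\rho}{v_{\max}}\,\mathrm{OPT}^{\mathrm H}_T(\bm v,\bm p)\Bigr]\ \ge\ 0 .$$ -/

import Mathlib

namespace Throttling

noncomputable section

/-- Revenue `(v - p)⁺` of entering a second-price auction with value `v` against the highest
competing bid `p`. -/
def revenue (v p : ℝ) : ℝ := max (v - p) 0

/-- Cost `p · 1[v ≥ p]` of entering a second-price auction with value `v` against the highest
competing bid `p`. -/
def cost (v p : ℝ) : ℝ := if p ≤ v then p else 0

/-- The hindsight throttling benchmark: the maximum over `x ∈ {0,1}^T` of the total revenue of `x`,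
subject to the total cost of `x` being at most `T ρ`. -/
def hindsight (ρ : ℝ) {T : ℕ} (v p : Fin T → ℝ) : ℝ :=
  sSup {R : ℝ | ∃ x : Fin T → ℝ, (∀ t, x t = 0 ∨ x t = 1) ∧
    ∑ t, x t * cost (v t) (p t) ≤ T * ρ ∧ R = ∑ t, x t * revenue (v t) (p t)}

/-! ### The OGD-CB algorithm with full information feedback

The rounds `1, …, T` are indexed by `t : Fin T`, so that `t` is the round with number `t.val + 1`. -/

/-- The variables of OGD-CB at the start of a round. -/
structure State (T : ℕ) where
  /-- the set of the past rounds whose highest competing bid has been observed -/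
  sampled : Finset (Fin T)
  /-- the remaining budget -/
  budget : ℝ
  /-- the pricing variable -/
  lam : ℝ
  /-- whether the loop has been left by `break` -/
  halted : Bool

/-- The initial variables, with total budget `B = ρ T`. -/
def State.init (ρ : ℝ) (T : ℕ) : State T where
  sampled := ∅
  budget := ρ * T
  lam := 0
  halted := false

/-- The confidence radius `√((ln 2 + 2 ln T) / (2 |I|))`. -/
def radius {T : ℕ} (I : Finset (Fin T)) : ℝ :=
  Real.sqrt ((Real.log 2 + 2 * Real.log T) / (2 * (I.card : ℝ)))

/-- The (optimistic) estimate of the expected revenue at value `w` from the bids observed in `I`. -/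
def estRevenue {T : ℕ} (p : Fin T → ℝ) (I : Finset (Fin T)) (w : ℝ) : ℝ :=
  (∑ τ ∈ I, revenue w (p τ)) / (I.card : ℝ) + radius I * w

/-- The (optimistic) estimate of the expected cost at value `w` from the bids observed in `I`. -/
def estCost {T : ℕ} (p : Fin T → ℝ) (I : Finset (Fin T)) (w : ℝ) : ℝ :=
  (∑ τ ∈ I, cost w (p τ)) / (I.card : ℝ) - 2 * radius I * w

/-- The decision `x_t ∈ {0,1}` in round `t`, at value `w`, from the variables `s` at the start of
the round. The first round is always entered; no round is entered after the loop was left. -/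
def action {T : ℕ} (p : Fin T → ℝ) (s : State T) (t : Fin T) (w : ℝ) : ℝ :=
  if s.halted then 0
  else if t.val = 0 then 1
  else if s.lam * estCost p s.sampled w ≤ estRevenue p s.sampled w then 1
  else 0

/-- The step size `1 / (v_max √t)`. -/
def stepSize (vmax : ℝ) {T : ℕ} (t : Fin T) : ℝ :=
  1 / (vmax * Real.sqrt ((t.val : ℝ) + 1))

/-- The variables after round `t`. With full information feedback `p t` is observed at the end of
the round whatever the decision was. -/
def step (vmax ρ : ℝ) {T : ℕ} (v p : Fin T → ℝ) (s : State T) (t : Fin T) : State T :=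
  if s.halted then s
  else
    { sampled := insert t s.sampled
      budget := s.budget - action p s t (v t) * cost (v t) (p t)
      lam :=
        if t.val = 0 then s.lam
        else max (s.lam +
          stepSize vmax t * (action p s t (v t) * estCost p s.sampled (v t) - ρ)) 0
      halted := decide (s.budget - action p s t (v t) * cost (v t) (p t) < vmax) }

/-- `stateAt vmax ρ v p n`: the variables after the first `n` rounds. -/
def stateAt (vmax ρ : ℝ) {T : ℕ} (v p : Fin T → ℝ) : ℕ → State T
  | 0 => State.init ρ T
  | n + 1 =>
      if h : n < T then step vmax ρ v p (stateAt vmax ρ v p n) ⟨n, h⟩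
      else stateAt vmax ρ v p n

/-- The total revenue of OGD-CB with values `v` and highest competing bids `p`. The decision is `0`
after the last entered round, so summing over all rounds is the same as stopping there. -/
def ogdcbRevenue (vmax ρ : ℝ) {T : ℕ} (v p : Fin T → ℝ) : ℝ :=
  ∑ t : Fin T, action p (stateAt vmax ρ v p t.val) t (v t) * revenue (v t) (p t)

/-- The revenue of OGD-CB minus `μ` times the hindsight benchmark, for values and bids in
`[0, v_max]`. -/
def gap (vmax ρ μ : ℝ) {T : ℕ} (v p : Fin T → Set.Icc (0 : ℝ) vmax) : ℝ :=
  ogdcbRevenue vmax ρ (fun t => (v t : ℝ)) (fun t => (p t : ℝ)) -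
    μ * hindsight ρ (fun t => (v t : ℝ)) (fun t => (p t : ℝ))

end

end Throttling

open MeasureTheory Finset

namespace Throttling

/-! ### Elementary bounds -/

/-! Put `α = ρ / vmax`, and let `r̄_t`, `c̄_t` be the expected revenue and cost at value `v_t`.
Entering with probability `α` costs at most `α * vmax = ρ` per round in expectation, whatever the
values. The benchmark never exceeds the revenue of entering every round, so its mean is at most `∑
r̄_t`. It therefore suffices that OGD-CB earns `α ∑ r̄_t - o(T)` in expectation, uniformly in the
values and in `G`.

The decision maximises `x (r̃_t - λ_t c̃_t)` over `x ∈ [0,1]`. Comparing with `x = α` gives `x_t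
r̃_t ≥ α r̃_t + λ_t g_t`, where `g_t = x_t c̃_t - ρ` (`estRevenue_mul_decision_ge`). Gradient ascent
guarantees `∑ g_t λ_t ≥ l ∑ g_t - R` for every `l ∈ [0,1]` (`neg_regretBound_le`). If the run is
never halted, `l = 0` is enough. If it is halted, take `l = 1`: nearly the whole budget `ρ T` has
been spent, so `∑ g_t` over the active rounds is, up to errors, at least `ρ` times the number of
lost rounds. A lost round is worth at most `α * vmax = ρ`, so the loss is paid for (`run_bound`).

It remains to replace estimates by means. Decisions depend on past bids only, so `E[x_t r_t] = E[x_t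
r̄_t]` (`integral_mul_eval_pi`), and the sampling errors are controlled by orthogonality of
martingale differences (`integral_sq_predictable_sum_le`). The radii are never used as confidence
bounds: they are just errors of order `√(log T / t)`. As `λ_t = O(√log T)` (`lam_mem_Icc`), `R =
O(√T log T)`, and the total loss is `o(T)`. -/

theorem sub_le_sum_of_increment_le {T : ℕ} (Φ : ℕ → ℝ) (F : Fin T → ℝ)
    (h : ∀ t : Fin T, Φ (t.val + 1) - Φ t.val ≤ F t) : Φ T - Φ 0 ≤ ∑ t, F t := by
  rw [← Finset.sum_range_sub, ← Fin.sum_univ_eq_sum_range (fun i => Φ (i + 1) - Φ i) T]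
  exact Finset.sum_le_sum fun t _ => h t

theorem one_div_sqrt_le (n : ℕ) :
    1 / Real.sqrt ((n : ℝ) + 1) ≤ 2 * Real.sqrt ((n : ℝ) + 1) - 2 * Real.sqrt n := by
  have h0 : (0 : ℝ) ≤ n := n.cast_nonneg
  have hb : 0 < Real.sqrt ((n : ℝ) + 1) := Real.sqrt_pos.2 (by linarith)
  have h1 := Real.sq_sqrt h0
  have h2 := Real.sq_sqrt (show (0 : ℝ) ≤ (n : ℝ) + 1 by linarith)
  rw [div_le_iff₀ hb]
  nlinarith [sq_nonneg (Real.sqrt ((n : ℝ) + 1) - Real.sqrt n)]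

theorem sum_one_div_sqrt_le (T : ℕ) :
    ∑ t : Fin T, 1 / Real.sqrt (t.val : ℝ) ≤ 2 * Real.sqrt T := by
  cases T with
  | zero => simp
  | succ n =>
    -- The round with index `0` contributes `1 / √0 = 0`, so the sum really starts at `1`.
    rw [Fin.sum_univ_succ]
    have h := sub_le_sum_of_increment_le (T := n) (fun k => -(2 * Real.sqrt k))
      (fun t => -(1 / Real.sqrt ((t.val : ℝ) + 1)))
      (fun t => by have := one_div_sqrt_le t.val; push_cast; linarith)
    have h3 : Real.sqrt n ≤ Real.sqrt ((n : ℝ) + 1) := Real.sqrt_le_sqrt (by linarith)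
    simp only [Finset.sum_neg_distrib, Nat.cast_zero, Real.sqrt_zero] at h
    simp only [Fin.val_zero, Nat.cast_zero, Real.sqrt_zero, div_zero, Fin.val_succ, Nat.cast_add,
      Nat.cast_one, zero_add]
    linarith

theorem revenue_nonneg (v p : ℝ) : 0 ≤ revenue v p := le_max_right _ _

theorem revenue_le {v p : ℝ} (hv : 0 ≤ v) (hp : 0 ≤ p) : revenue v p ≤ v :=
  max_le (by linarith) hv

theorem cost_nonneg {v p : ℝ} (hp : 0 ≤ p) : 0 ≤ cost v p := by
  unfold cost; split_ifs <;> simp [hp]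

theorem cost_le {v p : ℝ} (hv : 0 ≤ v) : cost v p ≤ v := by
  unfold cost; split_ifs <;> assumption

/-- The scale of the confidence radii in a run of `T` rounds. -/
noncomputable def radiusScale (T : ℕ) : ℝ := Real.sqrt ((Real.log 2 + 2 * Real.log T) / 2)

theorem radiusScale_nonneg (T : ℕ) : 0 ≤ radiusScale T := Real.sqrt_nonneg _

theorem radius_Iio {T : ℕ} (t : Fin T) :
    radius (Finset.Iio t) = radiusScale T * (1 / Real.sqrt t.val) := by
  unfold radius radiusScale
  rw [Fin.card_Iio, ← div_div, Real.sqrt_div' _ (Nat.cast_nonneg _), mul_one_div]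

theorem radius_Iio_le {T : ℕ} (t : Fin T) : radius (Finset.Iio t) ≤ radiusScale T := by
  rw [radius_Iio]
  refine mul_le_of_le_one_right (radiusScale_nonneg T) ?_
  rcases Nat.eq_zero_or_pos t.val with h | h
  · simp [h]
  · have : (1 : ℝ) ≤ t.val := by exact_mod_cast h
    exact div_le_one_of_le₀ (Real.one_le_sqrt.2 this) (Real.sqrt_nonneg _)

/-- The average over the bids of the rounds before `t`. -/
noncomputable def empMean {T : ℕ} (f : ℝ → ℝ) (p : Fin T → ℝ) (t : Fin T) : ℝ :=
  (∑ τ ∈ Finset.Iio t, f (p τ)) / (t.val : ℝ)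

theorem empMean_nonneg {T : ℕ} {f : ℝ → ℝ} {p : Fin T → ℝ} (t : Fin T) (h : ∀ τ, 0 ≤ f (p τ)) :
    0 ≤ empMean f p t :=
  div_nonneg (Finset.sum_nonneg fun τ _ => h τ) (Nat.cast_nonneg _)

theorem empMean_le {T : ℕ} {f : ℝ → ℝ} {p : Fin T → ℝ} (t : Fin T) {b : ℝ} (hb : 0 ≤ b)
    (h : ∀ τ, f (p τ) ≤ b) : empMean f p t ≤ b := by
  refine div_le_of_le_mul₀ (Nat.cast_nonneg _) hb ?_
  refine (Finset.sum_le_card_nsmul _ _ b fun τ _ => h τ).trans ?_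
  rw [Fin.card_Iio, nsmul_eq_mul, mul_comm]

theorem estRevenue_Iio {T : ℕ} (p : Fin T → ℝ) (t : Fin T) (w : ℝ) :
    estRevenue p (Finset.Iio t) w =
      empMean (revenue w) p t + radiusScale T * (1 / Real.sqrt t.val) * w := by
  simp [estRevenue, empMean, radius_Iio, Fin.card_Iio]

theorem estCost_Iio {T : ℕ} (p : Fin T → ℝ) (t : Fin T) (w : ℝ) :
    estCost p (Finset.Iio t) w =
      empMean (cost w) p t - 2 * (radiusScale T * (1 / Real.sqrt t.val)) * w := by
  simp [estCost, empMean, radius_Iio, Fin.card_Iio]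

/-! ### The run of the algorithm -/

theorem stateAt_succ {T : ℕ} (vmax ρ : ℝ) (v p : Fin T → ℝ) (t : Fin T) :
    stateAt vmax ρ v p (t.val + 1) = step vmax ρ v p (stateAt vmax ρ v p t.val) t := by
  rw [stateAt, dif_pos t.isLt]

/-- Full feedback makes the sample set deterministic until the run stops; the estimates are thus
plain averages of i.i.d. bids, without selection bias. -/
theorem sampled_stateAt {T : ℕ} (vmax ρ : ℝ) (v p : Fin T → ℝ) (n : ℕ)
    (h : (stateAt vmax ρ v p n).halted = false) :
    (stateAt vmax ρ v p n).sampled = Finset.univ.filter fun τ => τ.val < n := by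
  induction n with
  | zero => simp [stateAt, State.init]
  | succ n ih =>
    by_cases hn : n < T
    · rw [stateAt_succ vmax ρ v p ⟨n, hn⟩] at h ⊢
      by_cases hh : (stateAt vmax ρ v p n).halted = true
      · simp [step, hh] at h
      · have hs : (step vmax ρ v p (stateAt vmax ρ v p n) ⟨n, hn⟩).sampled =
            insert ⟨n, hn⟩ (stateAt vmax ρ v p n).sampled := by simp [step, hh]
        rw [hs, ih (by simpa using hh)]
        ext τ
        simp only [Finset.mem_insert, Finset.mem_filter, Finset.mem_univ, true_and, Fin.ext_iff]
        omega
    · rw [stateAt, dif_neg hn] at h ⊢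
      rw [ih h]
      ext τ
      have := τ.isLt
      simp only [Finset.mem_filter, Finset.mem_univ, true_and]
      omega

theorem sampled_stateAt_fin {T : ℕ} (vmax ρ : ℝ) (v p : Fin T → ℝ) (t : Fin T)
    (h : (stateAt vmax ρ v p t.val).halted = false) :
    (stateAt vmax ρ v p t.val).sampled = Finset.Iio t := by
  rw [sampled_stateAt vmax ρ v p _ h]
  ext τ
  simp

/-- The decision of the algorithm in round `t`. -/
noncomputable def decision {T : ℕ} (vmax ρ : ℝ) (v p : Fin T → ℝ) (t : Fin T) : ℝ :=
  action p (stateAt vmax ρ v p t.val) t (v t)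

theorem decision_of_halted {T : ℕ} {vmax ρ : ℝ} {v p : Fin T → ℝ} {t : Fin T}
    (h : (stateAt vmax ρ v p t.val).halted = true) : decision vmax ρ v p t = 0 := by
  simp [decision, action, h]

theorem decision_of_not_halted {T : ℕ} {vmax ρ : ℝ} {v p : Fin T → ℝ} {t : Fin T}
    (h : (stateAt vmax ρ v p t.val).halted = false) :
    decision vmax ρ v p t = if t.val = 0 then 1 else
      if (stateAt vmax ρ v p t.val).lam * estCost p (Finset.Iio t) (v t) ≤
        estRevenue p (Finset.Iio t) (v t) then 1 else 0 := by
  simp [decision, action, h, sampled_stateAt_fin vmax ρ v p t h]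

theorem decision_eq_zero_or_one {T : ℕ} (vmax ρ : ℝ) (v p : Fin T → ℝ) (t : Fin T) :
    decision vmax ρ v p t = 0 ∨ decision vmax ρ v p t = 1 := by
  unfold decision action
  split_ifs <;> simp

theorem decision_nonneg {T : ℕ} (vmax ρ : ℝ) (v p : Fin T → ℝ) (t : Fin T) :
    0 ≤ decision vmax ρ v p t := by
  rcases decision_eq_zero_or_one vmax ρ v p t with h | h <;> simp [h]

theorem decision_le_one {T : ℕ} (vmax ρ : ℝ) (v p : Fin T → ℝ) (t : Fin T) :
    decision vmax ρ v p t ≤ 1 := by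
  rcases decision_eq_zero_or_one vmax ρ v p t with h | h <;> simp [h]

theorem stateAt_succ_of_halted {T : ℕ} {vmax ρ : ℝ} {v p : Fin T → ℝ} {t : Fin T}
    (h : (stateAt vmax ρ v p t.val).halted = true) :
    stateAt vmax ρ v p (t.val + 1) = stateAt vmax ρ v p t.val := by
  rw [stateAt_succ]; simp [step, h]

theorem stateAt_succ_of_not_halted {T : ℕ} {vmax ρ : ℝ} {v p : Fin T → ℝ} {t : Fin T}
    (h : (stateAt vmax ρ v p t.val).halted = false) :
    stateAt vmax ρ v p (t.val + 1) =
      { sampled := insert t (Finset.Iio t)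
        budget := (stateAt vmax ρ v p t.val).budget - decision vmax ρ v p t * cost (v t) (p t)
        lam := if t.val = 0 then (stateAt vmax ρ v p t.val).lam else
          max ((stateAt vmax ρ v p t.val).lam + stepSize vmax t *
            (decision vmax ρ v p t * estCost p (Finset.Iio t) (v t) - ρ)) 0
        halted := decide ((stateAt vmax ρ v p t.val).budget -
          decision vmax ρ v p t * cost (v t) (p t) < vmax) } := by
  rw [stateAt_succ]
  simp [step, h, decision, sampled_stateAt_fin vmax ρ v p t h]
  rfl

theorem lam_stateAt_zero {T : ℕ} (vmax ρ : ℝ) (v p : Fin T → ℝ) :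
    (stateAt vmax ρ v p 0).lam = 0 := rfl

theorem budget_stateAt_sub {T : ℕ} (vmax ρ : ℝ) (v p : Fin T → ℝ) (t : Fin T) :
    (stateAt vmax ρ v p (t.val + 1)).budget =
      (stateAt vmax ρ v p t.val).budget - decision vmax ρ v p t * cost (v t) (p t) := by
  by_cases h : (stateAt vmax ρ v p t.val).halted = true
  · rw [stateAt_succ_of_halted h, decision_of_halted h]; simp
  · rw [stateAt_succ_of_not_halted (by simpa using h)]

theorem budget_stateAt_final {T : ℕ} (vmax ρ : ℝ) (v p : Fin T → ℝ) :
    ρ * T - (stateAt vmax ρ v p T).budget ≤ ∑ t, decision vmax ρ v p t * cost (v t) (p t) := by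
  have h := sub_le_sum_of_increment_le (T := T) (fun n => -(stateAt vmax ρ v p n).budget)
    (fun t => decision vmax ρ v p t * cost (v t) (p t))
    (fun t => by rw [budget_stateAt_sub]; linarith)
  have h0 : (stateAt vmax ρ v p 0).budget = ρ * T := rfl
  rw [h0] at h
  linarith

theorem budget_lt_of_halted {T : ℕ} (vmax ρ : ℝ) (v p : Fin T → ℝ) (n : ℕ)
    (h : (stateAt vmax ρ v p n).halted = true) : (stateAt vmax ρ v p n).budget < vmax := by
  induction n with
  | zero => simp [stateAt, State.init] at h
  | succ n ih =>
    by_cases hn : n < T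
    · by_cases hh : (stateAt vmax ρ v p n).halted = true
      · rw [stateAt_succ_of_halted (t := ⟨n, hn⟩) hh]
        exact ih hh
      · rw [stateAt_succ_of_not_halted (t := ⟨n, hn⟩) (by simpa using hh)] at h ⊢
        simpa using h
    · rw [stateAt, dif_neg hn] at h ⊢
      exact ih h

theorem halted_mono {T : ℕ} (vmax ρ : ℝ) (v p : Fin T → ℝ) {m n : ℕ} (hmn : m ≤ n)
    (h : (stateAt vmax ρ v p m).halted = true) : (stateAt vmax ρ v p n).halted = true := by
  induction n, hmn using Nat.le_induction with
  | base => exact h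
  | succ n _ ih =>
    by_cases hn : n < T
    · rw [stateAt_succ_of_halted (t := ⟨n, hn⟩) ih]; exact ih
    · rw [stateAt, dif_neg hn]; exact ih

/-! ### Dependence on the observed bids only -/

theorem empMean_congr {T : ℕ} {f : ℝ → ℝ} {p q : Fin T → ℝ} (t : Fin T)
    (h : ∀ τ, τ < t → p τ = q τ) : empMean f p t = empMean f q t := by
  unfold empMean
  rw [Finset.sum_congr rfl fun τ hτ => by rw [h τ (Finset.mem_Iio.1 hτ)]]

/-- Predictability: this is what makes the decision in round `t` independent of the bid `p t`. -/
theorem stateAt_congr {T : ℕ} (vmax ρ : ℝ) (v : Fin T → ℝ) {p q : Fin T → ℝ} (n : ℕ)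
    (h : ∀ t : Fin T, t.val < n → p t = q t) :
    stateAt vmax ρ v p n = stateAt vmax ρ v q n := by
  induction n with
  | zero => rfl
  | succ n ih =>
    have ih := ih fun t ht => h t (by omega)
    by_cases hn : n < T
    · set t : Fin T := ⟨n, hn⟩ with ht
      change stateAt vmax ρ v p t.val = stateAt vmax ρ v q t.val at ih
      change stateAt vmax ρ v p (t.val + 1) = stateAt vmax ρ v q (t.val + 1)
      by_cases hp : (stateAt vmax ρ v p t.val).halted = true
      · rw [stateAt_succ_of_halted hp, stateAt_succ_of_halted (ih ▸ hp), ih]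
      · have hp : (stateAt vmax ρ v p t.val).halted = false := by simpa using hp
        have hq : (stateAt vmax ρ v q t.val).halted = false := ih ▸ hp
        have e : ∀ τ, τ < t → p τ = q τ := fun τ hτ => h τ (by
          have := Fin.lt_def.1 hτ
          simp only [ht] at this; omega)
        rw [stateAt_succ_of_not_halted hp, stateAt_succ_of_not_halted hq,
          decision_of_not_halted hp, decision_of_not_halted hq, ih, estCost_Iio, estCost_Iio,
          estRevenue_Iio, estRevenue_Iio, empMean_congr t e, empMean_congr t e,
          h t (by simp [ht])]
    · rw [stateAt, stateAt, dif_neg hn, dif_neg hn]; exact ih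

theorem decision_congr {T : ℕ} (vmax ρ : ℝ) (v : Fin T → ℝ) {p q : Fin T → ℝ} (t : Fin T)
    (h : ∀ τ, τ < t → p τ = q τ) : decision vmax ρ v p t = decision vmax ρ v q t := by
  have hs := stateAt_congr vmax ρ v t.val fun τ hτ => h τ (Fin.lt_def.2 hτ)
  by_cases hp : (stateAt vmax ρ v p t.val).halted = true
  · rw [decision_of_halted hp, decision_of_halted (hs ▸ hp)]
  · have hp : (stateAt vmax ρ v p t.val).halted = false := by simpa using hp
    rw [decision_of_not_halted hp, decision_of_not_halted (hs ▸ hp), hs, estCost_Iio, estCost_Iio,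
      estRevenue_Iio, estRevenue_Iio, empMean_congr t h, empMean_congr t h]

/-! ### Bounds along a run -/

section Path

variable {T : ℕ} {vmax ρ : ℝ} {v p : Fin T → ℝ}

theorem estCost_Iio_le (hv : ∀ t, v t ∈ Set.Icc 0 vmax) (hvm : 0 < vmax)
    (t : Fin T) : estCost p (Finset.Iio t) (v t) ≤ vmax := by
  have h1 : empMean (cost (v t)) p t ≤ vmax :=
    empMean_le t hvm.le fun τ => (cost_le (hv t).1).trans (hv t).2
  have h2 : 0 ≤ radiusScale T * (1 / Real.sqrt t.val) * v t :=
    mul_nonneg (mul_nonneg (radiusScale_nonneg T) (by positivity)) (hv t).1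
  rw [estCost_Iio]
  linarith

theorem neg_le_estCost_Iio (hv : ∀ t, v t ∈ Set.Icc 0 vmax) (hp : ∀ t, p t ∈ Set.Icc 0 vmax)
    (t : Fin T) : -(2 * radiusScale T * vmax) ≤ estCost p (Finset.Iio t) (v t) := by
  have h1 : 0 ≤ empMean (cost (v t)) p t := empMean_nonneg t fun τ => cost_nonneg (hp τ).1
  have h2 : radius (Finset.Iio t) * v t ≤ radiusScale T * vmax :=
    mul_le_mul (radius_Iio_le t) (hv t).2 (hv t).1 (radiusScale_nonneg T)
  rw [estCost_Iio, ← radius_Iio]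
  linarith

theorem estRevenue_Iio_le (hv : ∀ t, v t ∈ Set.Icc 0 vmax) (hp : ∀ t, p t ∈ Set.Icc 0 vmax)
    (hvm : 0 < vmax) (t : Fin T) :
    estRevenue p (Finset.Iio t) (v t) ≤ vmax * (1 + radiusScale T) := by
  have h1 : empMean (revenue (v t)) p t ≤ vmax :=
    empMean_le t hvm.le fun τ => (revenue_le (hv t).1 (hp τ).1).trans (hv t).2
  have h2 : radius (Finset.Iio t) * v t ≤ radiusScale T * vmax :=
    mul_le_mul (radius_Iio_le t) (hv t).2 (hv t).1 (radiusScale_nonneg T)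
  rw [estRevenue_Iio, ← radius_Iio]
  linarith

theorem stepSize_pos (hvm : 0 < vmax) (t : Fin T) : 0 < stepSize vmax t := by
  unfold stepSize; positivity

theorem stepSize_mul_le (hvm : 0 < vmax) (t : Fin T) : stepSize vmax t * vmax ≤ 1 := by
  have h : 1 ≤ Real.sqrt ((t.val : ℝ) + 1) := Real.one_le_sqrt.2 (by simp)
  have h' : stepSize vmax t * vmax = 1 / Real.sqrt ((t.val : ℝ) + 1) := by
    unfold stepSize; field_simp
  rw [h']
  exact div_le_one_of_le₀ h (by linarith)

/-- A bound of the pricing variable. -/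
noncomputable def lamBound (vmax ρ : ℝ) (T : ℕ) : ℝ := vmax * (1 + radiusScale T) / ρ + 1

theorem one_le_lamBound (hvm : 0 < vmax) (hρ : 0 < ρ) : 1 ≤ lamBound vmax ρ T := by
  have := radiusScale_nonneg T
  unfold lamBound
  have : 0 ≤ vmax * (1 + radiusScale T) / ρ := by positivity
  linarith

/-- The price can rise only in a round that is entered with `c̃ > ρ`. Entering means `λ c̃ ≤ r̃`, so
`λ` is then at most `r̃ / ρ`, and one step adds at most `1`. -/
theorem lam_mem_Icc (hρ : 0 < ρ) (hvm : 0 < vmax) (hv : ∀ t, v t ∈ Set.Icc 0 vmax)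
    (hp : ∀ t, p t ∈ Set.Icc 0 vmax) (n : ℕ) :
    (stateAt vmax ρ v p n).lam ∈ Set.Icc 0 (lamBound vmax ρ T) := by
  have hΛ := one_le_lamBound (T := T) hvm hρ
  induction n with
  | zero => rw [lam_stateAt_zero]; exact ⟨le_rfl, by linarith⟩
  | succ n ih =>
    by_cases hn : n < T
    · set t : Fin T := ⟨n, hn⟩
      change (stateAt vmax ρ v p t.val).lam ∈ _ at ih
      change (stateAt vmax ρ v p (t.val + 1)).lam ∈ _
      by_cases hh : (stateAt vmax ρ v p t.val).halted = true
      · rwa [stateAt_succ_of_halted hh]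
      · have hh : (stateAt vmax ρ v p t.val).halted = false := by simpa using hh
        rw [stateAt_succ_of_not_halted hh]
        dsimp only
        split_ifs with h0
        · exact ih
        · refine ⟨le_max_right _ _, max_le ?_ (by linarith)⟩
          rw [decision_of_not_halted hh, if_neg h0]
          set l := (stateAt vmax ρ v p t.val).lam
          set c := estCost p (Finset.Iio t) (v t)
          have hη := stepSize_pos hvm t
          have hc : c ≤ vmax := estCost_Iio_le hv hvm t
          split_ifs with hx
          · rcases le_or_gt c ρ with hcρ | hcρ
            · have : stepSize vmax t * (1 * c - ρ) ≤ 0 :=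
                mul_nonpos_of_nonneg_of_nonpos hη.le (by linarith)
              linarith [ih.2]
            · have h1 : l * ρ ≤ vmax * (1 + radiusScale T) :=
                (mul_le_mul_of_nonneg_left hcρ.le ih.1).trans
                  (hx.trans (estRevenue_Iio_le hv hp hvm t))
              have h2 : l ≤ vmax * (1 + radiusScale T) / ρ := (le_div_iff₀ hρ).2 h1
              have h3 : stepSize vmax t * (1 * c - ρ) ≤ 1 :=
                (mul_le_mul_of_nonneg_left (by linarith) hη.le).trans (stepSize_mul_le hvm t)
              unfold lamBound
              linarith
          · have : stepSize vmax t * (0 * c - ρ) ≤ 0 :=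
              mul_nonpos_of_nonneg_of_nonpos hη.le (by linarith)
            linarith [ih.2]
    · rw [stateAt, dif_neg hn]; exact ih

/-- The subgradient used in round `t`; it is `0` where the pricing variable is not updated. -/
noncomputable def subgrad (vmax ρ : ℝ) (v p : Fin T → ℝ) (t : Fin T) : ℝ :=
  if (stateAt vmax ρ v p t.val).halted = true ∨ t.val = 0 then 0
  else decision vmax ρ v p t * estCost p (Finset.Iio t) (v t) - ρ

theorem abs_subgrad_le (hρ : 0 < ρ) (hρv : ρ ≤ vmax) (hv : ∀ t, v t ∈ Set.Icc 0 vmax)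
    (hp : ∀ t, p t ∈ Set.Icc 0 vmax) (t : Fin T) :
    |subgrad vmax ρ v p t| ≤ vmax * (2 * radiusScale T + 1) := by
  have hvm : 0 < vmax := hρ.trans_le hρv
  have hL := radiusScale_nonneg T
  have h1 := estCost_Iio_le (p := p) hv hvm t
  have h2 := neg_le_estCost_Iio hv hp t
  have h3 : 0 ≤ radiusScale T * vmax := by positivity
  unfold subgrad
  split_ifs
  · rw [abs_zero]; positivity
  · rcases decision_eq_zero_or_one vmax ρ v p t with h | h <;> rw [h, abs_le] <;>
      constructor <;> linarith

/-- Projection onto `[0, ∞)` does not increase the distance to a point `l ≥ 0`. -/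
theorem lam_succ_sub_sq_le {l : ℝ} (hl : 0 ≤ l) (t : Fin T) :
    ((stateAt vmax ρ v p (t.val + 1)).lam - l) ^ 2 ≤
      ((stateAt vmax ρ v p t.val).lam - l + stepSize vmax t * subgrad vmax ρ v p t) ^ 2 := by
  unfold subgrad
  by_cases hh : (stateAt vmax ρ v p t.val).halted = true
  · simp [hh, stateAt_succ_of_halted hh]
  · have hh : (stateAt vmax ρ v p t.val).halted = false := by simpa using hh
    rw [stateAt_succ_of_not_halted hh]
    by_cases h0 : t.val = 0
    · simp [h0]
    · simp only [hh, h0, if_false, Bool.false_eq_true, or_self]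
      set y := stepSize vmax t * (decision vmax ρ v p t * estCost p (Finset.Iio t) (v t) - ρ)
      set m := (stateAt vmax ρ v p t.val).lam
      rcases le_total (m + y) 0 with hy | hy
      · rw [max_eq_right hy]; nlinarith
      · rw [max_eq_left hy]; exact le_of_eq (by ring)

/-- The regret of online gradient descent. -/
noncomputable def regretBound (vmax ρ : ℝ) (T : ℕ) : ℝ :=
  vmax * Real.sqrt T * (lamBound vmax ρ T ^ 2 / 2 + (2 * radiusScale T + 1) ^ 2)

theorem neg_regretBound_le (hρ : 0 < ρ) (hρv : ρ ≤ vmax) (hv : ∀ t, v t ∈ Set.Icc 0 vmax)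
    (hp : ∀ t, p t ∈ Set.Icc 0 vmax) {l : ℝ} (hl : l ∈ Set.Icc 0 1) :
    -regretBound vmax ρ T ≤
      ∑ t, subgrad vmax ρ v p t * ((stateAt vmax ρ v p t.val).lam - l) := by
  have hvm : 0 < vmax := hρ.trans_le hρv
  have hD : ∀ n, ((stateAt vmax ρ v p n).lam - l) ^ 2 ≤ lamBound vmax ρ T ^ 2 := by
    intro n
    have h1 := lam_mem_Icc hρ hvm hv hp n
    have h2 := one_le_lamBound (T := T) hvm hρ
    exact sq_le_sq' (by linarith [h1.1, hl.2]) (by linarith [h1.2, hl.1])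
  -- The potential weights the squared distance by `√n`, the inverse step size up to constants.
  -- Subtracting `Λ ^ 2` absorbs the growth of this weight, and the last term absorbs the squared
  -- gradients. It vanishes at `n = 0`, and dropping the square at `n = T` leaves `-regretBound`.
  have key := sub_le_sum_of_increment_le (T := T)
    (fun n => (((stateAt vmax ρ v p n).lam - l) ^ 2 - lamBound vmax ρ T ^ 2) *
      (vmax * Real.sqrt n / 2) - vmax * (2 * radiusScale T + 1) ^ 2 * Real.sqrt n)
    (fun t => subgrad vmax ρ v p t * ((stateAt vmax ρ v p t.val).lam - l)) ?_
  · have h0 : 0 ≤ ((stateAt vmax ρ v p T).lam - l) ^ 2 * (vmax * Real.sqrt T / 2) := by positivity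
    simp only [Nat.cast_zero, Real.sqrt_zero] at key
    unfold regretBound
    linarith
  · intro t
    have hD1 := hD t.val
    have hs := lam_succ_sub_sq_le (ρ := ρ) (v := v) (p := p) (vmax := vmax) hl.1 t
    have hg := abs_subgrad_le hρ hρv hv hp t
    have h1 := one_div_sqrt_le t.val
    push_cast
    set D := ((stateAt vmax ρ v p t.val).lam - l)
    set D' := ((stateAt vmax ρ v p (t.val + 1)).lam - l) ^ 2
    set g := subgrad vmax ρ v p t
    set b := Real.sqrt ((t.val : ℝ) + 1)
    set a := Real.sqrt (t.val : ℝ)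
    set Λ := lamBound vmax ρ T
    have hbpos : 0 < b := Real.sqrt_pos.2 (by positivity)
    have hη : stepSize vmax t = 1 / (vmax * b) := rfl
    rw [hη] at hs
    have hab : a ≤ b := Real.sqrt_le_sqrt (by linarith)
    have hg2 : g ^ 2 ≤ (vmax * (2 * radiusScale T + 1)) ^ 2 := by
      rw [← sq_abs]; exact pow_le_pow_left₀ (abs_nonneg _) hg 2
    have e1 : D' * (vmax * b / 2) ≤ D ^ 2 * (vmax * b / 2) + g * D + g ^ 2 / (2 * vmax) * (1 / b) := by
      have := mul_le_mul_of_nonneg_right hs (show 0 ≤ vmax * b / 2 by positivity)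
      refine this.trans (le_of_eq ?_)
      field_simp
      ring
    have e2 : g ^ 2 / (2 * vmax) * (1 / b) ≤
        (vmax * (2 * radiusScale T + 1) ^ 2 / 2) * (2 * b - 2 * a) := by
      refine mul_le_mul ?_ h1 (by positivity) (by positivity)
      rw [div_le_iff₀ (by positivity)]
      linarith
    have e3 : 0 ≤ (Λ ^ 2 - D ^ 2) * (vmax * (b - a) / 2) :=
      mul_nonneg (by linarith) (by
        have : 0 ≤ b - a := by linarith
        positivity)
    linarith

/-- One round of the algorithm, compared with entering with probability `ρ / vmax`. -/
theorem estRevenue_mul_decision_ge (hρ : 0 < ρ) (hρv : ρ ≤ vmax)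
    (hv : ∀ t, v t ∈ Set.Icc 0 vmax) (hp : ∀ t, p t ∈ Set.Icc 0 vmax) (t : Fin T)
    (hh : (stateAt vmax ρ v p t.val).halted = false) (h0 : t.val ≠ 0) :
    ρ / vmax * estRevenue p (Finset.Iio t) (v t) +
        subgrad vmax ρ v p t * (stateAt vmax ρ v p t.val).lam ≤
      decision vmax ρ v p t * estRevenue p (Finset.Iio t) (v t) := by
  have hvm : 0 < vmax := hρ.trans_le hρv
  have hα0 : 0 < ρ / vmax := by positivity
  have hα1 : ρ / vmax ≤ 1 := div_le_one_of_le₀ hρv hvm.le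
  have hc := estCost_Iio_le (p := p) hv hvm t
  have hl := (lam_mem_Icc hρ hvm hv hp t.val).1
  have hαc : ρ / vmax * estCost p (Finset.Iio t) (v t) ≤ ρ := by
    refine (mul_le_mul_of_nonneg_left hc hα0.le).trans (le_of_eq ?_)
    field_simp
  simp only [subgrad, hh, h0, Bool.false_eq_true, or_self, if_false]
  rw [decision_of_not_halted hh, if_neg h0]
  set r := estRevenue p (Finset.Iio t) (v t)
  set c := estCost p (Finset.Iio t) (v t)
  set l := (stateAt vmax ρ v p t.val).lam
  have h1 := mul_le_mul_of_nonneg_left hαc hl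
  -- Entering uses `(1 - α) (r - l c) ≥ 0`, staying out uses `α (l c - r) ≥ 0`; both then need `l α
  -- c ≤ l ρ`.
  split_ifs with hx
  · have := mul_le_mul_of_nonneg_right hα1 (sub_nonneg.2 hx)
    linarith
  · have := mul_nonneg hα0.le (sub_nonneg.2 (not_le.1 hx).le)
    linarith

end Path

/-- The error of the average over the bids of the rounds before `t` as an estimate of `m`. -/
noncomputable def deviation {T : ℕ} (f : ℝ → ℝ) (m : ℝ) (p : Fin T → ℝ) (t : Fin T) : ℝ :=
  if t.val = 0 then 0 else |empMean f p t - m|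

theorem deviation_nonneg {T : ℕ} (f : ℝ → ℝ) (m : ℝ) (p : Fin T → ℝ) (t : Fin T) :
    0 ≤ deviation f m p t := by
  unfold deviation; split_ifs <;> positivity

/-! ### Pathwise comparison with the stationary strategy -/

section Path

variable {T : ℕ} {vmax ρ : ℝ} {v p : Fin T → ℝ}

/-- The deviation counts twice because the estimate is replaced by its mean on both sides, with
weights `α` and `x_t`, each at most `1`. The optimism bonus is dropped on the benchmark side and
paid for on the other. The first round is entered outright, with no price update. -/
theorem round_bound (hρ : 0 < ρ) (hρv : ρ ≤ vmax)
    (hv : ∀ t, v t ∈ Set.Icc 0 vmax) (hp : ∀ t, p t ∈ Set.Icc 0 vmax) (t : Fin T) {rb : ℝ}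
    (hrb : 0 ≤ rb) (hh : (stateAt vmax ρ v p t.val).halted = false) :
    ρ / vmax * rb ≤ decision vmax ρ v p t * rb + 2 * deviation (revenue (v t)) rb p t +
      radiusScale T * (1 / Real.sqrt t.val) * vmax -
      subgrad vmax ρ v p t * (stateAt vmax ρ v p t.val).lam := by
  have hvm : 0 < vmax := hρ.trans_le hρv
  have hα0 : 0 < ρ / vmax := by positivity
  have hα1 : ρ / vmax ≤ 1 := div_le_one_of_le₀ hρv hvm.le
  have hε : 0 ≤ radiusScale T * (1 / Real.sqrt t.val) :=
    mul_nonneg (radiusScale_nonneg T) (by positivity)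
  by_cases h0 : t.val = 0
  · have hx : decision vmax ρ v p t = 1 := by simp [decision_of_not_halted hh, h0]
    have hs : subgrad vmax ρ v p t = 0 := by simp [subgrad, h0]
    have hd := deviation_nonneg (revenue (v t)) rb p t
    rw [hx, hs]
    have := mul_le_mul_of_nonneg_right hα1 hrb
    have := mul_nonneg hε hvm.le
    linarith
  · have key := estRevenue_mul_decision_ge hρ hρv hv hp t hh h0
    have hd : deviation (revenue (v t)) rb p t = |empMean (revenue (v t)) p t - rb| := by
      simp [deviation, h0]
    rw [hd]
    rw [estRevenue_Iio] at key
    have h1 := neg_abs_le (empMean (revenue (v t)) p t - rb)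
    have h2 := le_abs_self (empMean (revenue (v t)) p t - rb)
    set A := |empMean (revenue (v t)) p t - rb|
    set e := radiusScale T * (1 / Real.sqrt t.val)
    have hev : e * v t ≤ e * vmax := mul_le_mul_of_nonneg_left (hv t).2 hε
    have hev0 : 0 ≤ e * v t := mul_nonneg hε (hv t).1
    have hA : 0 ≤ A := abs_nonneg _
    have h3 : ρ / vmax * (rb - A) ≤
        ρ / vmax * (empMean (revenue (v t)) p t + e * v t) :=
      mul_le_mul_of_nonneg_left (by linarith) hα0.le
    have h4 : ρ / vmax * A ≤ A := mul_le_of_le_one_left hA hα1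
    have h5 : decision vmax ρ v p t * (empMean (revenue (v t)) p t + e * v t) ≤
        decision vmax ρ v p t * rb + (A + e * vmax) := by
      rcases decision_eq_zero_or_one vmax ρ v p t with h | h <;> rw [h]
      · linarith
      · linarith
    linarith

/-- The extra `vmax` covers the first round, which may cost that much without entering any
subgradient. -/
theorem neg_subgrad_le (hρ : 0 < ρ) (hρv : ρ ≤ vmax)
    (hv : ∀ t, v t ∈ Set.Icc 0 vmax) (t : Fin T) {cb : ℝ} (hcb : cb ≤ vmax)
    (hh : (stateAt vmax ρ v p t.val).halted = false) :
    -subgrad vmax ρ v p t ≤ -(decision vmax ρ v p t * cb) + deviation (cost (v t)) cb p t +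
      2 * (radiusScale T * (1 / Real.sqrt t.val) * vmax) + ρ + if t.val = 0 then vmax else 0 := by
  have hvm : 0 < vmax := hρ.trans_le hρv
  have hε : 0 ≤ radiusScale T * (1 / Real.sqrt t.val) :=
    mul_nonneg (radiusScale_nonneg T) (by positivity)
  by_cases h0 : t.val = 0
  · have hx : decision vmax ρ v p t = 1 := by simp [decision_of_not_halted hh, h0]
    have hs : subgrad vmax ρ v p t = 0 := by simp [subgrad, h0]
    have hd := deviation_nonneg (cost (v t)) cb p t
    rw [hx, hs, if_pos h0]
    have := mul_nonneg hε hvm.le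
    linarith
  · have hd : deviation (cost (v t)) cb p t = |empMean (cost (v t)) p t - cb| := by
      simp [deviation, h0]
    have hs : subgrad vmax ρ v p t =
        decision vmax ρ v p t * estCost p (Finset.Iio t) (v t) - ρ := by simp [subgrad, h0, hh]
    rw [hd, hs, if_neg h0, estCost_Iio]
    have h1 := neg_abs_le (empMean (cost (v t)) p t - cb)
    set A := |empMean (cost (v t)) p t - cb|
    set e := radiusScale T * (1 / Real.sqrt t.val)
    have hev : e * v t ≤ e * vmax := mul_le_mul_of_nonneg_left (hv t).2 hε
    have hev0 : 0 ≤ e * v t := mul_nonneg hε (hv t).1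
    have hA : 0 ≤ A := abs_nonneg _
    rcases decision_eq_zero_or_one vmax ρ v p t with h | h <;> rw [h] <;> linarith

theorem sum_ite_val_eq_zero_le {b : ℝ} (hb : 0 ≤ b) :
    ∑ t : Fin T, (if t.val = 0 then b else 0) ≤ b := by
  cases T with
  | zero => simpa using hb
  | succ n => simp

theorem run_bound (hρ : 0 < ρ) (hρv : ρ ≤ vmax)
    (hv : ∀ t, v t ∈ Set.Icc 0 vmax) (hp : ∀ t, p t ∈ Set.Icc 0 vmax) {rb cb : Fin T → ℝ}
    (hrb : ∀ t, rb t ∈ Set.Icc 0 vmax) (hcb : ∀ t, cb t ∈ Set.Icc 0 vmax) :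
    ρ / vmax * ∑ t, rb t ≤ ∑ t, decision vmax ρ v p t * rb t +
      (2 * ∑ t, deviation (revenue (v t)) (rb t) p t + ∑ t, deviation (cost (v t)) (cb t) p t +
        |∑ t, decision vmax ρ v p t * (cost (v t) (p t) - cb t)|) +
      (6 * (radiusScale T * Real.sqrt T * vmax) + 2 * vmax + regretBound vmax ρ T) := by
  have hvm : 0 < vmax := hρ.trans_le hρv
  have hα0 : 0 < ρ / vmax := by positivity
  have hε : ∀ t : Fin T, 0 ≤ radiusScale T * (1 / Real.sqrt t.val) * vmax := fun t =>
    mul_nonneg (mul_nonneg (radiusScale_nonneg T) (by positivity)) hvm.le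
  have hεsum : ∑ t : Fin T, radiusScale T * (1 / Real.sqrt t.val) * vmax ≤
      2 * (radiusScale T * Real.sqrt T * vmax) := by
    rw [← Finset.sum_mul, ← Finset.mul_sum]
    have := mul_le_mul_of_nonneg_right
      (mul_le_mul_of_nonneg_left (sum_one_div_sqrt_le T) (radiusScale_nonneg T)) hvm.le
    linarith
  have hC : 0 ≤ ∑ t, deviation (cost (v t)) (cb t) p t :=
    Finset.sum_nonneg fun t _ => deviation_nonneg _ _ _ _
  have hM := abs_nonneg (∑ t, decision vmax ρ v p t * (cost (v t) (p t) - cb t))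
  have hE : 0 ≤ radiusScale T * Real.sqrt T * vmax :=
    mul_nonneg (mul_nonneg (radiusScale_nonneg T) (Real.sqrt_nonneg _)) hvm.le
  -- Halted runs are compared with `l = 1`, the others with `l = 0`. The two copies of `vmax` in the
  -- bound are the first round and the unspent budget, which is below `vmax`; the factor `6` is
  -- three radii per round times `∑ 1 / √t ≤ 2 √T`.
  by_cases hT : (stateAt vmax ρ v p T).halted = true
  · have hround : ∀ t : Fin T, ρ / vmax * rb t ≤ decision vmax ρ v p t * rb t +
        2 * deviation (revenue (v t)) (rb t) p t + deviation (cost (v t)) (cb t) p t +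
        3 * (radiusScale T * (1 / Real.sqrt t.val) * vmax) -
        subgrad vmax ρ v p t * ((stateAt vmax ρ v p t.val).lam - 1) -
        decision vmax ρ v p t * cb t + ρ + if t.val = 0 then vmax else 0 := by
      intro t
      by_cases hh : (stateAt vmax ρ v p t.val).halted = true
      · have hs : subgrad vmax ρ v p t = 0 := by simp [subgrad, hh]
        rw [hs, decision_of_halted hh]
        have h1 := deviation_nonneg (revenue (v t)) (rb t) p t
        have h2 := deviation_nonneg (cost (v t)) (cb t) p t
        have h3 := hε t
        have h4 : (0 : ℝ) ≤ if t.val = 0 then vmax else 0 := by split_ifs <;> linarith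
        -- After halting, the `+ ρ` of the round alone pays for the missed revenue.
        have h5 : ρ / vmax * rb t ≤ ρ :=
          (mul_le_mul_of_nonneg_left (hrb t).2 hα0.le).trans (le_of_eq (by field_simp))
        linarith
      · have hh : (stateAt vmax ρ v p t.val).halted = false := by simpa using hh
        have h1 := round_bound hρ hρv hv hp t (hrb t).1 hh
        have h2 := neg_subgrad_le hρ hρv hv t (hcb t).2 hh
        linarith
    have hsum := Finset.sum_le_sum fun t (_ : t ∈ Finset.univ) => hround t
    simp only [Finset.sum_add_distrib, Finset.sum_sub_distrib, ← Finset.mul_sum, Finset.sum_const,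
      Finset.card_univ, Fintype.card_fin, nsmul_eq_mul] at hsum
    have hreg := neg_regretBound_le hρ hρv hv hp (l := 1) ⟨zero_le_one, le_rfl⟩
    have hbud := budget_stateAt_final vmax ρ v p
    have hlt := budget_lt_of_halted vmax ρ v p T hT
    have hM' := le_abs_self (∑ t, decision vmax ρ v p t * (cost (v t) (p t) - cb t))
    have hsplit : ∑ t, decision vmax ρ v p t * (cost (v t) (p t) - cb t) =
        ∑ t, decision vmax ρ v p t * cost (v t) (p t) - ∑ t, decision vmax ρ v p t * cb t := by
      simp only [mul_sub, Finset.sum_sub_distrib]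
    have h0 := sum_ite_val_eq_zero_le (T := T) hvm.le
    simp only [← Finset.mul_sum, ← Finset.sum_mul] at hεsum hsum ⊢
    linarith
  · have hround : ∀ t : Fin T, ρ / vmax * rb t ≤ decision vmax ρ v p t * rb t +
        2 * deviation (revenue (v t)) (rb t) p t +
        radiusScale T * (1 / Real.sqrt t.val) * vmax -
        subgrad vmax ρ v p t * ((stateAt vmax ρ v p t.val).lam - 0) := by
      intro t
      have hh : (stateAt vmax ρ v p t.val).halted = false := by
        by_contra h
        exact hT (halted_mono vmax ρ v p t.isLt.le (by simpa using h))
      rw [sub_zero]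
      exact round_bound hρ hρv hv hp t (hrb t).1 hh
    have hsum := Finset.sum_le_sum fun t (_ : t ∈ Finset.univ) => hround t
    have hreg := neg_regretBound_le hρ hρv hv hp (l := 0) ⟨le_rfl, zero_le_one⟩
    simp only [Finset.sum_add_distrib, Finset.sum_sub_distrib] at hsum
    simp only [← Finset.mul_sum, ← Finset.sum_mul] at hεsum hsum ⊢
    linarith

end Path

/-! ### The hindsight benchmark -/

/-- A finite supremum makes measurability in the bids visible. Infeasible selections get the value
`0`, already attained by never entering, which is feasible as `ρ ≥ 0`. -/
theorem hindsight_eq_iSup {ρ : ℝ} (hρ : 0 ≤ ρ) {T : ℕ} (v p : Fin T → ℝ) :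
    hindsight ρ v p = ⨆ b : Fin T → Bool,
      if ∑ t, (if b t then cost (v t) (p t) else 0) ≤ T * ρ then
        ∑ t, (if b t then revenue (v t) (p t) else 0) else 0 := by
  set F : (Fin T → Bool) → ℝ := fun b =>
    if ∑ t, (if b t then cost (v t) (p t) else 0) ≤ T * ρ then
        ∑ t, (if b t then revenue (v t) (p t) else 0) else 0 with hF
  have h0 : (0 : ℝ) ≤ T * ρ := by positivity
  unfold hindsight iSup
  congr 1
  ext R
  constructor
  · rintro ⟨x, hx, hc, rfl⟩
    refine ⟨fun t => decide (x t = 1), ?_⟩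
    have e : ∀ f : Fin T → ℝ, ∑ t, (if decide (x t = 1) = true then f t else 0) =
        ∑ t, x t * f t := fun f => Finset.sum_congr rfl fun t _ => by
      rcases hx t with h | h <;> simp [h]
    simp only [hF, e, if_pos hc]
  · rintro ⟨b, rfl⟩
    by_cases hb : ∑ t, (if b t then cost (v t) (p t) else 0) ≤ T * ρ
    · refine ⟨fun t => if b t then 1 else 0, fun t => ?_, ?_, ?_⟩
      · by_cases h : b t <;> simp [h]
      · simpa [ite_mul] using hb
      · simp [hF, hb, ite_mul]
    · exact ⟨fun _ => 0, fun _ => Or.inl rfl, by simpa using h0, by simp [hF, hb]⟩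

theorem hindsight_nonneg {ρ : ℝ} {T : ℕ} (v p : Fin T → ℝ) : 0 ≤ hindsight ρ v p := by
  refine Real.sSup_nonneg ?_
  rintro _ ⟨x, hx, -, rfl⟩
  refine Finset.sum_nonneg fun t _ => mul_nonneg ?_ (revenue_nonneg _ _)
  rcases hx t with h | h <;> simp [h]

theorem hindsight_le {ρ : ℝ} {T : ℕ} (v p : Fin T → ℝ) :
    hindsight ρ v p ≤ ∑ t, revenue (v t) (p t) := by
  refine Real.sSup_le ?_ (Finset.sum_nonneg fun t _ => revenue_nonneg _ _)
  rintro _ ⟨x, hx, -, rfl⟩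
  refine Finset.sum_le_sum fun t _ => mul_le_of_le_one_left (revenue_nonneg _ _) ?_
  rcases hx t with h | h <;> simp [h]

/-! ### Predictable functions of independent samples -/

section Probability

variable {Ω : Type*} [MeasurableSpace Ω] [Nonempty Ω] {T : ℕ}

theorem integral_mul_eval_pi (G : Measure Ω) [IsProbabilityMeasure G] {f : (Fin T → Ω) → ℝ}
    (hf : Measurable f) (t : Fin T) (hft : ∀ p q, (∀ τ, τ ≠ t → p τ = q τ) → f p = f q)
    {h : Ω → ℝ} (hh : Measurable h) :
    ∫ p, f p * h (p t) ∂(Measure.pi fun _ : Fin T => G) =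
      (∫ p, f p ∂(Measure.pi fun _ : Fin T => G)) * ∫ x, h x ∂G := by
  classical
  obtain ⟨ω₀⟩ := ‹Nonempty Ω›
  have hind := ProbabilityTheory.iIndepFun_pi (μ := fun _ : Fin T => G)
    (X := fun _ => (id : Ω → Ω)) (fun _ => aemeasurable_id)
  have hdisj : Disjoint ({t}ᶜ : Finset (Fin T)) {t} := disjoint_compl_left
  have h2 := hind.indepFun_finset _ _ hdisj (fun i => measurable_pi_apply i)
  -- Filling coordinate `t` with an arbitrary `ω₀` writes `f` as a function of the other
  -- coordinates, which are independent of the coordinate `t`.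
  let ext : (({t}ᶜ : Finset (Fin T)) → Ω) → (Fin T → Ω) := fun y i =>
    if hi : i ∈ ({t}ᶜ : Finset (Fin T)) then y ⟨i, hi⟩ else ω₀
  have hext : Measurable ext := by
    refine measurable_pi_iff.2 fun i => ?_
    by_cases hi : i ∈ ({t}ᶜ : Finset (Fin T))
    · simp only [ext, dif_pos hi]; exact measurable_pi_apply _
    · simp only [ext, dif_neg hi]; exact measurable_const
  have h3 := h2.comp (φ := fun y => f (ext y))
    (ψ := fun y : ({t} : Finset (Fin T)) → Ω => h (y ⟨t, Finset.mem_singleton_self t⟩))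
    (hf.comp hext) (hh.comp (measurable_pi_apply _))
  have h4 := h3.integral_fun_mul_eq_mul_integral
    ((hf.comp hext).comp (measurable_pi_iff.2 fun i => measurable_pi_apply _)).aestronglyMeasurable
    ((hh.comp (measurable_pi_apply _)).comp
      (measurable_pi_iff.2 fun i => measurable_pi_apply _)).aestronglyMeasurable
  have e : ∀ p : Fin T → Ω, f (ext fun i => p i) = f p := fun p => hft _ _ fun τ hτ => by
    simp [ext, hτ]
  simp only [Function.comp_def, id, e] at h4
  rw [h4]
  congr 1
  exact integral_comp_eval (μ := fun _ : Fin T => G) (i := t) hh.aestronglyMeasurable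

theorem integrable_of_measurable_of_abs_le {α : Type*} [MeasurableSpace α] {μ : Measure α}
    [IsFiniteMeasure μ] {f : α → ℝ} (hf : Measurable f) (C : ℝ) (h : ∀ x, |f x| ≤ C) :
    Integrable f μ :=
  Integrable.of_bound hf.aestronglyMeasurable C (Filter.Eventually.of_forall h)

theorem filter_val_lt_succ (t : Fin T) :
    (Finset.univ.filter fun τ : Fin T => τ.val < t.val + 1) =
      insert t (Finset.univ.filter fun τ : Fin T => τ.val < t.val) := by
  ext τ
  simp only [Finset.mem_insert, Finset.mem_filter, Finset.mem_univ, true_and, Fin.ext_iff]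
  omega

/-- The terms are martingale differences, so the cross terms integrate to zero and only the `n`
squares remain. -/
theorem integral_sq_predictable_sum_le (G : Measure Ω) [IsProbabilityMeasure G]
    {X : Fin T → (Fin T → Ω) → ℝ} (hX : ∀ t, Measurable (X t)) (hX1 : ∀ t p, |X t p| ≤ 1)
    (hXt : ∀ t p q, (∀ τ, τ < t → p τ = q τ) → X t p = X t q)
    {h : Fin T → Ω → ℝ} (hh : ∀ t, Measurable (h t)) {B : ℝ} (hB : ∀ t x, |h t x| ≤ B)
    (h0 : ∀ t, ∫ x, h t x ∂G = 0) {n : ℕ} (hn : n ≤ T) :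
    ∫ p, (∑ t ∈ Finset.univ.filter (fun τ : Fin T => τ.val < n), X t p * h t (p t)) ^ 2
      ∂(Measure.pi fun _ : Fin T => G) ≤ n * B ^ 2 := by
  induction n with
  | zero => simp
  | succ n ih =>
    have ih := ih (by omega)
    set t : Fin T := ⟨n, by omega⟩ with ht
    have hfil := filter_val_lt_succ t
    change (Finset.univ.filter fun τ : Fin T => τ.val < n + 1) =
      insert t (Finset.univ.filter fun τ : Fin T => τ.val < n) at hfil
    set S : (Fin T → Ω) → ℝ := fun p =>
      ∑ t ∈ Finset.univ.filter (fun τ : Fin T => τ.val < n), X t p * h t (p t) with hS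
    have hY : ∀ t : Fin T, Measurable fun p : Fin T → Ω => X t p * h t (p t) := fun t =>
      (hX t).mul ((hh t).comp (measurable_pi_apply t))
    have hYB : ∀ t p, |X t p * h t (p t)| ≤ B := fun t p => by
      rw [abs_mul]
      exact (mul_le_of_le_one_left (abs_nonneg _) (hX1 t p)).trans (hB t _)
    have hSm : Measurable S := Finset.measurable_sum _ fun t _ => hY t
    have hSB : ∀ p, |S p| ≤ T * B := fun p => by
      have hB0 : 0 ≤ B := (abs_nonneg _).trans (hYB t p)
      refine (Finset.abs_sum_le_sum_abs _ _).trans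
        ((Finset.sum_le_card_nsmul _ _ B fun i _ => hYB i p).trans ?_)
      rw [nsmul_eq_mul]
      refine mul_le_mul_of_nonneg_right ?_ hB0
      exact_mod_cast (Finset.card_le_univ _).trans (by simp)
    have hsq : ∀ {a b : ℝ}, |a| ≤ b → |a ^ 2| ≤ b ^ 2 := fun {a b} hab => by
      rw [abs_pow]; exact pow_le_pow_left₀ (abs_nonneg _) hab 2
    have hmul : ∀ p, |S p * X t p * h t (p t)| ≤ T * B * B := fun p => by
      rw [mul_assoc, abs_mul]
      exact mul_le_mul (hSB p) (hYB t p) (abs_nonneg _) ((abs_nonneg _).trans (hSB p))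
    -- `S * X t` involves only the bids before `t`, so the centred factor `h t (p t)` splits off.
    have hSX : ∫ p, S p * X t p * h t (p t) ∂(Measure.pi fun _ : Fin T => G) = 0 := by
      refine (integral_mul_eval_pi G (f := fun p => S p * X t p) (hSm.mul (hX t)) t ?_
        (hh t)).trans (by rw [h0 t, mul_zero])
      intro p q hpq
      have hlt : ∀ τ : Fin T, τ < t → p τ = q τ := fun τ hτ => hpq τ hτ.ne
      simp only [hS]
      rw [hXt t p q hlt]
      congr 1
      refine Finset.sum_congr rfl fun τ hτ => ?_
      have hτ' : τ < t := Fin.lt_def.2 (Finset.mem_filter.1 hτ).2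
      rw [hXt τ p q fun σ hσ => hlt σ (hσ.trans hτ'), hlt τ hτ']
    have heq : ∀ p, (∑ t ∈ Finset.univ.filter (fun τ : Fin T => τ.val < n + 1),
        X t p * h t (p t)) ^ 2 =
        S p ^ 2 + 2 * (S p * X t p * h t (p t)) + (X t p * h t (p t)) ^ 2 := fun p => by
      rw [hfil, Finset.sum_insert (by simp [ht])]
      simp only [hS]
      ring
    have i1 : Integrable (fun p => S p ^ 2) (Measure.pi fun _ : Fin T => G) :=
      integrable_of_measurable_of_abs_le (hSm.pow_const 2) _ fun p => hsq (hSB p)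
    have i2 : Integrable (fun p => S p * X t p * h t (p t)) (Measure.pi fun _ : Fin T => G) :=
      integrable_of_measurable_of_abs_le
        ((hSm.mul (hX t)).mul ((hh t).comp (measurable_pi_apply t))) _ hmul
    have i3 : Integrable (fun p => (X t p * h t (p t)) ^ 2) (Measure.pi fun _ : Fin T => G) :=
      integrable_of_measurable_of_abs_le ((hY t).pow_const 2) _ fun p => hsq (hYB t p)
    have i12 : Integrable (fun p => S p ^ 2 + 2 * (S p * X t p * h t (p t)))
        (Measure.pi fun _ : Fin T => G) := i1.add (i2.const_mul 2)
    simp only [heq]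
    rw [integral_add i12 i3, integral_add i1 (i2.const_mul 2),
      integral_const_mul, hSX]
    have h3 : ∫ p, (X t p * h t (p t)) ^ 2 ∂(Measure.pi fun _ : Fin T => G) ≤ B ^ 2 := by
      refine (integral_mono i3 (integrable_const (B ^ 2)) fun p => ?_).trans (by simp)
      exact (le_abs_self _).trans (hsq (hYB t p))
    push_cast
    linarith

theorem integral_abs_le_of_integral_sq_le {α : Type*} [MeasurableSpace α] {μ : Measure α}
    [IsProbabilityMeasure μ] {f : α → ℝ} (hf : Measurable f) {C : ℝ} (hC : ∀ x, |f x| ≤ C)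
    {s : ℝ} (hs : 0 < s) (h : ∫ x, f x ^ 2 ∂μ ≤ s ^ 2) : ∫ x, |f x| ∂μ ≤ s := by
  have i1 : Integrable (fun x => |f x|) μ :=
    integrable_of_measurable_of_abs_le (measurable_norm.comp hf) C fun x => by simpa using hC x
  have i2 : Integrable (fun x => f x ^ 2) μ :=
    integrable_of_measurable_of_abs_le (hf.pow_const 2) (C ^ 2) fun x => by
      rw [abs_pow]; exact pow_le_pow_left₀ (abs_nonneg _) (hC x) 2
  -- This integrates `2 s |f| ≤ f ^ 2 + s ^ 2`, in place of Cauchy–Schwarz.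
  have h1 : ∫ x, 2 * s * |f x| ∂μ ≤ ∫ x, (f x ^ 2 + s ^ 2) ∂μ :=
    integral_mono (i1.const_mul _) (i2.add (integrable_const _)) fun x => by
      have := sq_nonneg (|f x| - s)
      have h2 := sq_abs (f x)
      dsimp only
      linarith
  rw [integral_const_mul, integral_add i2 (integrable_const _)] at h1
  simp only [integral_const, probReal_univ, one_smul] at h1
  have : 2 * s * ∫ x, |f x| ∂μ ≤ 2 * s * s := by linarith
  exact le_of_mul_le_mul_left this (by positivity)

end Probability

/-! ### Measurability -/

theorem measurable_revenue (w : ℝ) : Measurable (revenue w) :=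
  (measurable_const.sub measurable_id).max measurable_const

theorem measurable_cost (w : ℝ) : Measurable (cost w) :=
  Measurable.ite measurableSet_Iic measurable_id measurable_const

theorem measurable_empMean {T : ℕ} {f : ℝ → ℝ} (hf : Measurable f) (t : Fin T) :
    Measurable fun p : Fin T → ℝ => empMean f p t :=
  (Finset.measurable_sum _ fun τ _ => hf.comp (measurable_pi_apply τ)).div_const _

theorem measurable_estCost_Iio {T : ℕ} (t : Fin T) (w : ℝ) :
    Measurable fun p : Fin T → ℝ => estCost p (Finset.Iio t) w := by
  simp only [estCost_Iio]
  exact (measurable_empMean (measurable_cost w) t).sub_const _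

theorem measurable_estRevenue_Iio {T : ℕ} (t : Fin T) (w : ℝ) :
    Measurable fun p : Fin T → ℝ => estRevenue p (Finset.Iio t) w := by
  simp only [estRevenue_Iio]
  exact (measurable_empMean (measurable_revenue w) t).add_const _

theorem measurable_decision_of {T : ℕ} {vmax ρ : ℝ} {v : Fin T → ℝ} (t : Fin T)
    (hl : Measurable fun p : Fin T → ℝ => (stateAt vmax ρ v p t.val).lam)
    (hh : MeasurableSet {p : Fin T → ℝ | (stateAt vmax ρ v p t.val).halted = true}) :
    Measurable fun p : Fin T → ℝ => decision vmax ρ v p t := by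
  have e : (fun p : Fin T → ℝ => decision vmax ρ v p t) = fun p =>
      if (stateAt vmax ρ v p t.val).halted = true then 0 else
        if t.val = 0 then 1 else if (stateAt vmax ρ v p t.val).lam *
          estCost p (Finset.Iio t) (v t) ≤ estRevenue p (Finset.Iio t) (v t) then 1 else 0 := by
    funext p
    by_cases h : (stateAt vmax ρ v p t.val).halted = true
    · rw [decision_of_halted h, if_pos h]
    · rw [decision_of_not_halted (by simpa using h), if_neg h]
  rw [e]
  refine Measurable.ite hh measurable_const ?_
  by_cases h0 : t.val = 0
  · simp only [h0, if_true]; exact measurable_const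
  · simp only [h0, if_false]
    exact Measurable.ite (measurableSet_le (hl.mul (measurable_estCost_Iio t _))
      (measurable_estRevenue_Iio t _)) measurable_const measurable_const

/-- The three components are proved together, since each update passes through the decision, which
reads both the price and the halting flag. -/
theorem measurable_stateAt {T : ℕ} (vmax ρ : ℝ) (v : Fin T → ℝ) (n : ℕ) :
    Measurable (fun p : Fin T → ℝ => (stateAt vmax ρ v p n).lam) ∧
    Measurable (fun p : Fin T → ℝ => (stateAt vmax ρ v p n).budget) ∧
    MeasurableSet {p : Fin T → ℝ | (stateAt vmax ρ v p n).halted = true} := by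
  induction n with
  | zero => exact ⟨measurable_const, measurable_const, MeasurableSet.const (false = true)⟩
  | succ n ih =>
    by_cases hn : n < T
    · set t : Fin T := ⟨n, hn⟩
      obtain ⟨hl, hb, hh⟩ : Measurable (fun p : Fin T → ℝ => (stateAt vmax ρ v p t.val).lam) ∧
        Measurable (fun p : Fin T → ℝ => (stateAt vmax ρ v p t.val).budget) ∧
        MeasurableSet {p : Fin T → ℝ | (stateAt vmax ρ v p t.val).halted = true} := ih
      have hd := measurable_decision_of t hl hh
      have hb' : Measurable fun p : Fin T → ℝ => (stateAt vmax ρ v p (t.val + 1)).budget := by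
        simp only [budget_stateAt_sub]
        exact hb.sub (hd.mul ((measurable_cost (v t)).comp (measurable_pi_apply t)))
      refine ⟨?_, hb', ?_⟩
      · have e : (fun p : Fin T → ℝ => (stateAt vmax ρ v p (t.val + 1)).lam) = fun p =>
            if (stateAt vmax ρ v p t.val).halted = true then (stateAt vmax ρ v p t.val).lam
            else if t.val = 0 then (stateAt vmax ρ v p t.val).lam else
              max ((stateAt vmax ρ v p t.val).lam + stepSize vmax t *
                (decision vmax ρ v p t * estCost p (Finset.Iio t) (v t) - ρ)) 0 := by
          funext p
          by_cases h : (stateAt vmax ρ v p t.val).halted = true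
          · rw [stateAt_succ_of_halted h, if_pos h]
          · rw [stateAt_succ_of_not_halted (by simpa using h), if_neg h]
        change Measurable fun p : Fin T → ℝ => (stateAt vmax ρ v p (t.val + 1)).lam
        rw [e]
        refine Measurable.ite hh hl ?_
        by_cases h0 : t.val = 0
        · simp only [h0, if_true] at hl ⊢; exact hl
        · simp only [h0, if_false]
          exact (hl.add (((hd.mul (measurable_estCost_Iio t _)).sub_const _).const_mul _)).max
            measurable_const
      · have e : {p : Fin T → ℝ | (stateAt vmax ρ v p (t.val + 1)).halted = true} =
            {p | (stateAt vmax ρ v p t.val).halted = true} ∪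
              {p | (stateAt vmax ρ v p (t.val + 1)).budget < vmax} := by
          ext p
          by_cases h : (stateAt vmax ρ v p t.val).halted = true
          · simp [stateAt_succ_of_halted h, h]
          · have h : (stateAt vmax ρ v p t.val).halted = false := by simpa using h
            simp [stateAt_succ_of_not_halted h, h]
        change MeasurableSet {p : Fin T → ℝ | (stateAt vmax ρ v p (t.val + 1)).halted = true}
        rw [e]
        exact hh.union (measurableSet_lt hb' measurable_const)
    · simp only [stateAt, dif_neg hn]; exact ih

theorem measurable_decision {T : ℕ} (vmax ρ : ℝ) (v : Fin T → ℝ) (t : Fin T) :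
    Measurable fun p : Fin T → ℝ => decision vmax ρ v p t :=
  measurable_decision_of t (measurable_stateAt vmax ρ v t.val).1 (measurable_stateAt vmax ρ v t.val).2.2

theorem measurable_hindsight {ρ : ℝ} (hρ : 0 ≤ ρ) {T : ℕ} (v : Fin T → ℝ) :
    Measurable fun p : Fin T → ℝ => hindsight ρ v p := by
  simp only [hindsight_eq_iSup hρ]
  have hm : ∀ (b : Fin T → Bool) {f : ℝ → ℝ → ℝ}, (∀ w, Measurable (f w)) →
      Measurable fun p : Fin T → ℝ => ∑ t, if b t then f (v t) (p t) else 0 := by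
    intro b f hf
    refine Finset.measurable_sum _ fun t _ => ?_
    by_cases h : b t
    · simp only [h, if_true]; exact (hf _).comp (measurable_pi_apply t)
    · simp only [h]; exact measurable_const
  exact Measurable.iSup fun b => Measurable.ite
    (measurableSet_le (hm b measurable_cost) measurable_const) (hm b measurable_revenue)
    measurable_const

/-! ### Expectations -/

section Expectation

variable {T : ℕ} {vmax ρ : ℝ}

/-- The bids as real numbers. -/
def bids (p : Fin T → Set.Icc (0 : ℝ) vmax) (t : Fin T) : ℝ := (p t : ℝ)

theorem bids_mem (p : Fin T → Set.Icc (0 : ℝ) vmax) (t : Fin T) : bids p t ∈ Set.Icc 0 vmax :=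
  (p t).2

theorem measurable_bids : Measurable (bids : (Fin T → Set.Icc (0 : ℝ) vmax) → Fin T → ℝ) :=
  measurable_pi_iff.2 fun t => measurable_subtype_coe.comp (measurable_pi_apply t)

theorem sum_revenue_le {v p : Fin T → ℝ} (hv : ∀ t, v t ∈ Set.Icc 0 vmax)
    (hp : ∀ t, p t ∈ Set.Icc 0 vmax) : ∑ t, revenue (v t) (p t) ≤ T * vmax := by
  refine (Finset.sum_le_card_nsmul _ _ vmax fun t _ =>
    (revenue_le (hv t).1 (hp t).1).trans (hv t).2).trans ?_
  simp

theorem ogdcbRevenue_eq (v p : Fin T → ℝ) :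
    ogdcbRevenue vmax ρ v p = ∑ t, decision vmax ρ v p t * revenue (v t) (p t) := rfl

theorem ogdcbRevenue_nonneg (v p : Fin T → ℝ) : 0 ≤ ogdcbRevenue vmax ρ v p :=
  Finset.sum_nonneg fun t _ => mul_nonneg (decision_nonneg vmax ρ v p t) (revenue_nonneg _ _)

theorem ogdcbRevenue_le (v p : Fin T → ℝ) :
    ogdcbRevenue vmax ρ v p ≤ ∑ t, revenue (v t) (p t) :=
  Finset.sum_le_sum fun t _ =>
    mul_le_of_le_one_left (revenue_nonneg _ _) (decision_le_one vmax ρ v p t)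

theorem measurable_ogdcbRevenue (v : Fin T → ℝ) :
    Measurable fun p : Fin T → ℝ => ogdcbRevenue vmax ρ v p :=
  Finset.measurable_sum _ fun t _ =>
    (measurable_decision vmax ρ v t).mul ((measurable_revenue _).comp (measurable_pi_apply t))

variable (v : Fin T → Set.Icc (0 : ℝ) vmax) (μ : Measure (Fin T → Set.Icc (0 : ℝ) vmax))
  [IsProbabilityMeasure μ]

theorem integrable_ogdcbRevenue :
    Integrable (fun p => ogdcbRevenue vmax ρ (bids v) (bids p)) μ :=
  integrable_of_measurable_of_abs_le ((measurable_ogdcbRevenue _).comp measurable_bids) (T * vmax)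
    fun p => by
      rw [abs_of_nonneg (ogdcbRevenue_nonneg _ _)]
      exact (ogdcbRevenue_le _ _).trans (sum_revenue_le (bids_mem v) (bids_mem p))

theorem integrable_hindsight (hρ : 0 ≤ ρ) :
    Integrable (fun p => hindsight ρ (bids v) (bids p)) μ :=
  integrable_of_measurable_of_abs_le ((measurable_hindsight hρ _).comp measurable_bids) (T * vmax)
    fun p => by
      rw [abs_of_nonneg (hindsight_nonneg _ _)]
      exact (hindsight_le _ _).trans (sum_revenue_le (bids_mem v) (bids_mem p))

theorem integrable_gap (hρ : 0 ≤ ρ) (c : ℝ) : Integrable (fun p => gap vmax ρ c v p) μ :=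
  (integrable_ogdcbRevenue v μ).sub ((integrable_hindsight v μ hρ).const_mul c)

end Expectation

/-! ### Concentration for i.i.d. bids and the expected gap -/

section IID

variable {T : ℕ} {vmax ρ : ℝ} (G : Measure (Set.Icc (0 : ℝ) vmax)) [IsProbabilityMeasure G]

theorem integral_coe_mem_Icc {f : ℝ → ℝ} (hf : Measurable f)
    (hfb : ∀ x ∈ Set.Icc 0 vmax, f x ∈ Set.Icc 0 vmax) :
    ∫ x : Set.Icc (0 : ℝ) vmax, f x ∂G ∈ Set.Icc 0 vmax := by
  have hi : Integrable (fun x : Set.Icc (0 : ℝ) vmax => f x) G :=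
    integrable_of_measurable_of_abs_le (hf.comp measurable_subtype_coe) vmax fun x => by
      rw [abs_of_nonneg (hfb x x.2).1]; exact (hfb x x.2).2
  refine ⟨integral_nonneg fun x => (hfb x x.2).1, ?_⟩
  refine (integral_mono hi (integrable_const vmax) fun x => (hfb x x.2).2).trans ?_
  simp

theorem integral_coe_sub_integral {f : ℝ → ℝ} (hf : Measurable f)
    (hfb : ∀ x ∈ Set.Icc 0 vmax, f x ∈ Set.Icc 0 vmax) :
    ∫ x : Set.Icc (0 : ℝ) vmax, (f x - ∫ y : Set.Icc (0 : ℝ) vmax, f y ∂G) ∂G = 0 := by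
  have hi : Integrable (fun x : Set.Icc (0 : ℝ) vmax => f x) G :=
    integrable_of_measurable_of_abs_le (hf.comp measurable_subtype_coe) vmax fun x => by
      rw [abs_of_nonneg (hfb x x.2).1]; exact (hfb x x.2).2
  rw [integral_sub hi (integrable_const _)]
  simp

theorem abs_sub_le_of_mem_Icc_zero {a b c : ℝ} (ha : a ∈ Set.Icc 0 c) (hb : b ∈ Set.Icc 0 c) :
    |a - b| ≤ c :=
  abs_le.2 ⟨by linarith [ha.1, hb.2], by linarith [ha.2, hb.1]⟩

theorem integral_abs_predictable_sum_le (hvm : 0 < vmax) {X : Fin T → (Fin T → ℝ) → ℝ}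
    (hX : ∀ t, Measurable (X t)) (hX1 : ∀ t p, |X t p| ≤ 1)
    (hXt : ∀ t p q, (∀ τ, τ < t → p τ = q τ) → X t p = X t q)
    {f : Fin T → ℝ → ℝ} (hf : ∀ t, Measurable (f t))
    (hfb : ∀ t, ∀ x ∈ Set.Icc 0 vmax, f t x ∈ Set.Icc 0 vmax) {n : ℕ} (hn : n ≤ T) (hn0 : 0 < n) :
    ∫ p, |∑ t ∈ Finset.univ.filter (fun τ : Fin T => τ.val < n), X t (bids p) *
        (f t (bids p t) - ∫ y : Set.Icc (0 : ℝ) vmax, f t y ∂G)|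
      ∂(Measure.pi fun _ : Fin T => G) ≤ vmax * Real.sqrt n := by
  have : Nonempty (Set.Icc (0 : ℝ) vmax) := ⟨⟨0, le_rfl, hvm.le⟩⟩
  have hsq := integral_sq_predictable_sum_le G (X := fun t p => X t (bids p))
    (fun t => (hX t).comp measurable_bids) (fun t p => hX1 t _)
    (fun t p q h => hXt t _ _ fun τ hτ => by simp [bids, h τ hτ])
    (h := fun t x => f t x - ∫ y : Set.Icc (0 : ℝ) vmax, f t y ∂G)
    (fun t => ((hf t).comp measurable_subtype_coe).sub_const _) (B := vmax)
    (fun t x => abs_sub_le_of_mem_Icc_zero (hfb t x x.2) (integral_coe_mem_Icc G (hf t) (hfb t)))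
    (fun t => integral_coe_sub_integral G (hf t) (hfb t)) hn
  have hn' : (0 : ℝ) < n := by exact_mod_cast hn0
  refine integral_abs_le_of_integral_sq_le ?_ (C := T * vmax) ?_ (by positivity) ?_
  · exact Finset.measurable_sum _ fun t _ => ((hX t).comp measurable_bids).mul
      (((hf t).comp ((measurable_pi_apply t).comp measurable_bids)).sub_const _)
  · intro p
    refine (Finset.abs_sum_le_sum_abs _ _).trans
      ((Finset.sum_le_card_nsmul _ _ vmax fun t _ => ?_).trans ?_)
    · rw [abs_mul]
      exact (mul_le_of_le_one_left (abs_nonneg _) (hX1 t _)).trans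
        (abs_sub_le_of_mem_Icc_zero (hfb t _ (bids_mem p t))
          (integral_coe_mem_Icc G (hf t) (hfb t)))
    · rw [nsmul_eq_mul]
      refine mul_le_mul_of_nonneg_right ?_ hvm.le
      exact_mod_cast (Finset.card_le_univ _).trans (by simp)
  · rw [mul_pow, Real.sq_sqrt hn'.le, mul_comm]
    exact hsq

theorem measurable_deviation {f : ℝ → ℝ} (hf : Measurable f) (m : ℝ) (t : Fin T) :
    Measurable fun p : Fin T → ℝ => deviation f m p t := by
  unfold deviation
  split_ifs
  · exact measurable_const
  · exact measurable_norm.comp ((measurable_empMean hf t).sub_const m)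

theorem deviation_le {f : ℝ → ℝ} (hvm : 0 < vmax)
    (hfb : ∀ x ∈ Set.Icc 0 vmax, f x ∈ Set.Icc 0 vmax) {m : ℝ} (hm : m ∈ Set.Icc 0 vmax)
    {p : Fin T → ℝ} (hp : ∀ t, p t ∈ Set.Icc 0 vmax) (t : Fin T) : deviation f m p t ≤ vmax := by
  unfold deviation
  split_ifs
  · exact hvm.le
  · exact abs_sub_le_of_mem_Icc_zero ⟨empMean_nonneg t fun τ => (hfb _ (hp τ)).1,
      empMean_le t hvm.le fun τ => (hfb _ (hp τ)).2⟩ hm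

theorem integrable_deviation {f : ℝ → ℝ} (hf : Measurable f) (hvm : 0 < vmax)
    (hfb : ∀ x ∈ Set.Icc 0 vmax, f x ∈ Set.Icc 0 vmax) {m : ℝ} (hm : m ∈ Set.Icc 0 vmax)
    (μ : Measure (Fin T → Set.Icc (0 : ℝ) vmax)) [IsProbabilityMeasure μ] (t : Fin T) :
    Integrable (fun p => deviation f m (bids p) t) μ :=
  integrable_of_measurable_of_abs_le ((measurable_deviation hf m t).comp measurable_bids) vmax
    fun p => by
      rw [abs_of_nonneg (deviation_nonneg _ _ _ _)]
      exact deviation_le hvm hfb hm (bids_mem p) t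

theorem integral_deviation_le (hvm : 0 < vmax) {f : ℝ → ℝ} (hf : Measurable f)
    (hfb : ∀ x ∈ Set.Icc 0 vmax, f x ∈ Set.Icc 0 vmax) (t : Fin T) :
    ∫ p, deviation f (∫ y : Set.Icc (0 : ℝ) vmax, f y ∂G) (bids p) t
      ∂(Measure.pi fun _ : Fin T => G) ≤ vmax * (1 / Real.sqrt t.val) := by
  by_cases h0 : t.val = 0
  · simp [deviation, h0]
  · have ht : (0 : ℝ) < t.val := by exact_mod_cast Nat.pos_of_ne_zero h0
    -- The constant weights `X = 1` turn the martingale bound into one for the empirical mean.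
    have h := integral_abs_predictable_sum_le G hvm (T := T) (X := fun _ _ => 1)
      (fun _ => measurable_const) (fun _ _ => by simp) (fun _ _ _ _ => rfl) (f := fun _ => f)
      (fun _ => hf) (fun _ => hfb) t.isLt.le (Nat.pos_of_ne_zero h0)
    have e : ∀ p : Fin T → Set.Icc (0 : ℝ) vmax,
        deviation f (∫ y : Set.Icc (0 : ℝ) vmax, f y ∂G) (bids p) t =
        (1 / t.val) * |∑ τ ∈ Finset.univ.filter (fun τ : Fin T => τ.val < t.val), 1 *
          (f (bids p τ) - ∫ y : Set.Icc (0 : ℝ) vmax, f y ∂G)| := fun p => by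
      have hI : Finset.univ.filter (fun τ : Fin T => τ.val < t.val) = Finset.Iio t := by
        ext τ; simp
      rw [deviation, if_neg h0, hI, ← abs_of_pos (one_div_pos.2 ht), ← abs_mul]
      congr 1
      simp only [one_mul, Finset.sum_sub_distrib, Finset.sum_const, Fin.card_Iio, nsmul_eq_mul,
        empMean]
      field_simp
    simp only [e]
    rw [integral_const_mul]
    refine (mul_le_mul_of_nonneg_left h (by positivity)).trans (le_of_eq ?_)
    have hs : Real.sqrt t.val * Real.sqrt t.val = t.val := Real.mul_self_sqrt ht.le
    have hs0 : 0 < Real.sqrt (t.val : ℝ) := Real.sqrt_pos.2 ht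
    field_simp
    rw [sq, hs]

/-- A lower bound of the expected gap is minus this quantity. -/
noncomputable def lossBound (vmax ρ : ℝ) (T : ℕ) : ℝ :=
  7 * (vmax * Real.sqrt T) +
    (6 * (radiusScale T * Real.sqrt T * vmax) + 2 * vmax + regretBound vmax ρ T)

/-- Integrates `run_bound`. The factor `7` collects `2 * 2` from the revenue deviations, `2` from
the cost deviations and `1` from the martingale of realised costs. -/
theorem neg_lossBound_le_integral_gap (hρ : 0 < ρ) (hρv : ρ ≤ vmax) (hT : 0 < T)
    (v : Fin T → Set.Icc (0 : ℝ) vmax) :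
    -lossBound vmax ρ T ≤
      ∫ p, gap vmax ρ (ρ / vmax) v p ∂(Measure.pi fun _ : Fin T => G) := by
  have hvm : 0 < vmax := hρ.trans_le hρv
  have : Nonempty (Set.Icc (0 : ℝ) vmax) := ⟨⟨0, le_rfl, hvm.le⟩⟩
  set μ := Measure.pi fun _ : Fin T => G
  set w := bids v
  have hwm : ∀ t, w t ∈ Set.Icc 0 vmax := bids_mem v
  have hrev : ∀ t, ∀ x ∈ Set.Icc 0 vmax, revenue (w t) x ∈ Set.Icc 0 vmax := fun t x hx =>
    ⟨revenue_nonneg _ _, (revenue_le (hwm t).1 hx.1).trans (hwm t).2⟩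
  have hcost : ∀ t, ∀ x ∈ Set.Icc 0 vmax, cost (w t) x ∈ Set.Icc 0 vmax := fun t x hx =>
    ⟨cost_nonneg hx.1, (cost_le (hwm t).1).trans (hwm t).2⟩
  set rb : Fin T → ℝ := fun t => ∫ y : Set.Icc (0 : ℝ) vmax, revenue (w t) y ∂G
  set cb : Fin T → ℝ := fun t => ∫ y : Set.Icc (0 : ℝ) vmax, cost (w t) y ∂G
  have hrbm : ∀ t, rb t ∈ Set.Icc 0 vmax := fun t =>
    integral_coe_mem_Icc G (measurable_revenue _) (hrev t)
  have hcbm : ∀ t, cb t ∈ Set.Icc 0 vmax := fun t =>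
    integral_coe_mem_Icc G (measurable_cost _) (hcost t)
  have hxm : ∀ t, Measurable fun p : Fin T → Set.Icc (0 : ℝ) vmax =>
      decision vmax ρ w (bids p) t := fun t =>
    (measurable_decision vmax ρ w t).comp measurable_bids
  have hx1 : ∀ (t : Fin T) (p : Fin T → ℝ), |decision vmax ρ w p t| ≤ 1 := fun t p => by
    rw [abs_of_nonneg (decision_nonneg _ _ _ _ _)]; exact decision_le_one _ _ _ _ _
  have hbm : ∀ t, Measurable fun p : Fin T → Set.Icc (0 : ℝ) vmax => bids p t := fun t =>
    (measurable_pi_apply t).comp measurable_bids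
  have hprod : ∀ (t : Fin T) (p : Fin T → ℝ) {y : ℝ}, |y| ≤ vmax →
      |decision vmax ρ w p t * y| ≤ vmax := fun t p y hy => by
    rw [abs_mul]; exact (mul_le_of_le_one_left (abs_nonneg _) (hx1 t p)).trans hy
  have habs : ∀ {y : ℝ}, y ∈ Set.Icc 0 vmax → |y| ≤ vmax := fun {y} hy => by
    rw [abs_of_nonneg hy.1]; exact hy.2
  have ix : ∀ t, Integrable (fun p => decision vmax ρ w (bids p) t * rb t) μ := fun t =>
    integrable_of_measurable_of_abs_le ((hxm t).mul_const _) vmax fun p =>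
      hprod t _ (habs (hrbm t))
  have ixr : ∀ t, Integrable
      (fun p => decision vmax ρ w (bids p) t * revenue (w t) (bids p t)) μ := fun t =>
    integrable_of_measurable_of_abs_le ((hxm t).mul ((measurable_revenue _).comp (hbm t))) vmax
      fun p => hprod t _ (habs (hrev t _ (bids_mem p t)))
  have ir : ∀ t, Integrable (fun p : Fin T → Set.Icc (0 : ℝ) vmax => revenue (w t) (bids p t)) μ :=
    fun t => integrable_of_measurable_of_abs_le ((measurable_revenue _).comp (hbm t)) vmax
      fun p => habs (hrev t _ (bids_mem p t))
  -- Predictability lets the realised revenue be replaced by its mean round by round, at no loss.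
  have hER : ∫ p, ogdcbRevenue vmax ρ w (bids p) ∂μ =
      ∫ p, ∑ t, decision vmax ρ w (bids p) t * rb t ∂μ := by
    simp only [ogdcbRevenue_eq]
    rw [integral_finsetSum _ fun t _ => ixr t, integral_finsetSum _ fun t _ => ix t]
    refine Finset.sum_congr rfl fun t _ => ?_
    rw [integral_mul_const]
    refine integral_mul_eval_pi G (hxm t) t ?_
      (h := fun x : Set.Icc (0 : ℝ) vmax => revenue (w t) x)
      ((measurable_revenue _).comp measurable_subtype_coe)
    intro p q hpq
    exact decision_congr vmax ρ w t fun τ hτ => by simp [bids, hpq τ hτ.ne]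
  have hEH : ∫ p, hindsight ρ w (bids p) ∂μ ≤ ∑ t, rb t := by
    refine (integral_mono (integrable_hindsight v μ hρ.le)
      (integrable_finsetSum _ fun t _ => ir t) fun p => hindsight_le w (bids p)).trans ?_
    rw [integral_finsetSum _ fun t _ => ir t]
    refine Finset.sum_le_sum fun t _ => le_of_eq ?_
    exact integral_comp_eval (μ := fun _ : Fin T => G) (i := t)
      (f := fun x : Set.Icc (0 : ℝ) vmax => revenue (w t) x)
      ((measurable_revenue _).comp measurable_subtype_coe).aestronglyMeasurable
  set M : (Fin T → Set.Icc (0 : ℝ) vmax) → ℝ := fun p =>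
    |∑ t, decision vmax ρ w (bids p) t * (cost (w t) (bids p t) - cb t)|
  have hEM : ∫ p, M p ∂μ ≤ vmax * Real.sqrt T := by
    have h := integral_abs_predictable_sum_le G hvm (X := fun t p => decision vmax ρ w p t)
      (measurable_decision vmax ρ w) hx1 (fun t p q h => decision_congr vmax ρ w t h)
      (f := fun t => cost (w t)) (fun t => measurable_cost _) hcost le_rfl hT
    have hu : Finset.univ.filter (fun τ : Fin T => τ.val < T) = Finset.univ := by
      ext τ; simp
    rw [hu] at h
    exact h
  have iM : Integrable M μ := by
    refine Integrable.abs (integrable_finsetSum _ fun t _ =>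
      integrable_of_measurable_of_abs_le
        ((hxm t).mul (((measurable_cost _).comp (hbm t)).sub_const _)) vmax fun p =>
          hprod t _ (abs_sub_le_of_mem_Icc_zero (hcost t _ (bids_mem p t)) (hcbm t)))
  have iA := fun t => integrable_deviation (measurable_revenue (w t)) hvm (hrev t) (hrbm t) μ t
  have iC := fun t => integrable_deviation (measurable_cost (w t)) hvm (hcost t) (hcbm t) μ t
  have hsum : ∀ (f : Fin T → ℝ → ℝ), (∀ t, Measurable (f t)) →
      (∀ t, ∀ x ∈ Set.Icc 0 vmax, f t x ∈ Set.Icc 0 vmax) →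
      ∑ t, ∫ p, deviation (f t) (∫ y : Set.Icc (0 : ℝ) vmax, f t y ∂G) (bids p) t ∂μ ≤
        2 * (vmax * Real.sqrt T) := fun f hf hfb => by
    refine (Finset.sum_le_sum fun t _ => integral_deviation_le G hvm (hf t) (hfb t) t).trans ?_
    rw [← Finset.mul_sum]
    have := mul_le_mul_of_nonneg_left (sum_one_div_sqrt_le T) hvm.le
    linarith
  have hA := hsum _ (fun t => measurable_revenue (w t)) hrev
  have hC := hsum _ (fun t => measurable_cost (w t)) hcost
  have iX := integrable_finsetSum Finset.univ fun t _ => ix t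
  have iAs := (integrable_finsetSum Finset.univ fun t _ => iA t).const_mul 2
  have iCs := integrable_finsetSum Finset.univ fun t _ => iC t
  set K := 6 * (radiusScale T * Real.sqrt T * vmax) + 2 * vmax + regretBound vmax ρ T with hK
  have hrun := integral_mono (μ := μ) (integrable_const (ρ / vmax * ∑ t, rb t))
    ((iX.add ((iAs.add iCs).add iM)).add (integrable_const K))
    fun p => run_bound hρ hρv hwm (bids_mem p) hrbm hcbm
  rw [integral_add' (iX.add ((iAs.add iCs).add iM)) (integrable_const K),
    integral_add' iX ((iAs.add iCs).add iM), integral_add' (iAs.add iCs) iM,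
    integral_add' iAs iCs, integral_const_mul (2 : ℝ), integral_finsetSum _ fun t _ => iA t,
    integral_finsetSum _ fun t _ => iC t, ← hER] at hrun
  simp only [integral_const, probReal_univ, one_smul] at hrun
  have hgap : ∫ p, gap vmax ρ (ρ / vmax) v p ∂μ =
      ∫ p, ogdcbRevenue vmax ρ w (bids p) ∂μ - ρ / vmax * ∫ p, hindsight ρ w (bids p) ∂μ := by
    rw [← integral_const_mul, ← integral_sub (integrable_ogdcbRevenue v μ)
      ((integrable_hindsight v μ hρ.le).const_mul _)]
    rfl
  have hα : ρ / vmax * ∫ p, hindsight ρ w (bids p) ∂μ ≤ ρ / vmax * ∑ t, rb t :=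
    mul_le_mul_of_nonneg_left hEH (by positivity)
  rw [hgap]
  unfold lossBound
  rw [← hK]
  linarith

end IID

/-! ### Asymptotics -/

theorem tendsto_sqrt_div_atTop :
    Filter.Tendsto (fun T : ℕ => Real.sqrt T / T) Filter.atTop (nhds 0) := by
  have h : Filter.Tendsto (fun T : ℕ => (Real.sqrt T)⁻¹) Filter.atTop (nhds 0) :=
    (Real.tendsto_sqrt_atTop.comp tendsto_natCast_atTop_atTop).inv_tendsto_atTop
  refine h.congr fun T => ?_
  rw [Real.sqrt_div_self']
  simp

theorem tendsto_log_mul_sqrt_div_atTop :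
    Filter.Tendsto (fun T : ℕ => Real.log T * (Real.sqrt T / T)) Filter.atTop (nhds 0) := by
  have h := ((isLittleO_log_rpow_atTop (r := 1 / 2) (by norm_num)).tendsto_div_nhds_zero).comp
    (tendsto_natCast_atTop_atTop (R := ℝ))
  refine h.congr fun T => ?_
  simp only [Function.comp_apply, ← Real.sqrt_eq_rpow, Real.sqrt_div_self']
  ring

theorem tendsto_radiusScale_sq_mul :
    Filter.Tendsto (fun T : ℕ => radiusScale T ^ 2 * (Real.sqrt T / T)) Filter.atTop (nhds 0) := by
  have h := (tendsto_sqrt_div_atTop.const_mul (Real.log 2 / 2)).add tendsto_log_mul_sqrt_div_atTop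
  simp only [mul_zero, add_zero] at h
  refine h.congr' ?_
  filter_upwards [Filter.eventually_ge_atTop 1] with T hT
  have h1 : 0 ≤ Real.log T := Real.log_nonneg (by exact_mod_cast hT)
  have h2 : 0 ≤ Real.log 2 := Real.log_nonneg (by norm_num)
  rw [radiusScale, Real.sq_sqrt (by positivity)]
  ring

theorem tendsto_radiusScale_mul :
    Filter.Tendsto (fun T : ℕ => radiusScale T * (Real.sqrt T / T)) Filter.atTop (nhds 0) := by
  have h := tendsto_sqrt_div_atTop.add tendsto_radiusScale_sq_mul
  rw [add_zero] at h
  refine squeeze_zero (fun T => mul_nonneg (radiusScale_nonneg T) (by positivity)) (fun T => ?_) h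
  have hq : 0 ≤ Real.sqrt T / T := by positivity
  -- This dominates the first power by limits already known.
  have hs : radiusScale T ≤ 1 + radiusScale T ^ 2 := by nlinarith [sq_nonneg (radiusScale T - 1)]
  have := mul_le_mul_of_nonneg_right hs hq
  linarith

theorem tendsto_lossBound (vmax ρ : ℝ) :
    Filter.Tendsto (fun T : ℕ => 1 / (T : ℝ) * lossBound vmax ρ T) Filter.atTop (nhds 0) := by
  set a := vmax / ρ with ha
  -- The coefficients come from expanding the loss in powers of `L = radiusScale T`, with `lamBound
  -- = (a + 1) + a L`.
  have h := (((tendsto_sqrt_div_atTop.const_mul (7 * vmax + vmax * ((a + 1) ^ 2 / 2 + 1))).add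
    (tendsto_radiusScale_mul.const_mul (6 * vmax + vmax * (a * (a + 1) + 4)))).add
    (tendsto_radiusScale_sq_mul.const_mul (vmax * (a ^ 2 / 2 + 4)))).add
    (tendsto_one_div_atTop_nhds_zero_nat.const_mul (2 * vmax))
  simp only [mul_zero, add_zero] at h
  refine h.congr fun T => ?_
  unfold lossBound regretBound lamBound
  rw [mul_div_right_comm, ← ha]
  ring

end Throttling

theorem mainTheorem5 (vmax ρ : ℝ) (hρ : 0 < ρ) (hρv : ρ ≤ vmax) :
    (∀ (T : ℕ) (v : Fin T → Set.Icc (0 : ℝ) vmax)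
        (G : MeasureTheory.ProbabilityMeasure (Set.Icc (0 : ℝ) vmax)),
      MeasureTheory.Integrable
        (fun p : Fin T → Set.Icc (0 : ℝ) vmax => Throttling.gap vmax ρ (ρ / vmax) v p)
        (MeasureTheory.Measure.pi
          (fun _ : Fin T => (G : MeasureTheory.Measure (Set.Icc (0 : ℝ) vmax))))) ∧
    (0 : EReal) ≤ Filter.liminf
      (fun T : ℕ =>
        ⨅ (v : Fin T → Set.Icc (0 : ℝ) vmax)
          (G : MeasureTheory.ProbabilityMeasure (Set.Icc (0 : ℝ) vmax)),
          (((1 / (T : ℝ)) *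
            ∫ p : Fin T → Set.Icc (0 : ℝ) vmax, Throttling.gap vmax ρ (ρ / vmax) v p
              ∂(MeasureTheory.Measure.pi
                (fun _ : Fin T => (G : MeasureTheory.Measure (Set.Icc (0 : ℝ) vmax)))) : ℝ) :
            EReal))
      Filter.atTop := by
  have hvm : 0 < vmax := hρ.trans_le hρv
  refine ⟨fun T v G => Throttling.integrable_gap v _ hρ.le _, ?_⟩
  have hlim : Filter.Tendsto
      (fun T : ℕ => ((-(1 / (T : ℝ) * Throttling.lossBound vmax ρ T) : ℝ) : EReal))
      Filter.atTop (nhds 0) := by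
    have h := (Throttling.tendsto_lossBound vmax ρ).neg
    rw [neg_zero] at h
    exact (continuous_coe_real_ereal.tendsto (0 : ℝ)).comp h
  rw [← hlim.liminf_eq]
  refine Filter.liminf_le_liminf ?_
  filter_upwards [Filter.eventually_gt_atTop 0] with T hT
  -- The loss bound depends on neither `v` nor `G`, so it passes to the infimum.
  refine le_iInf fun v => le_iInf fun G => EReal.coe_le_coe_iff.2 ?_
  rw [← mul_neg]
  exact mul_le_mul_of_nonneg_left
    (Throttling.neg_lossBound_le_integral_gap (G : MeasureTheory.Measure _) hρ hρv hT v)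
    (by positivity)
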